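/- Bochner-type formula. Let $M$ be a smooth (Hausdorff) manifold of dimension $2n+1$ with a CR structure of CR dimension $n$, with maximally complex distribution $H(M)$ and complex structure $J$ on $H(M)$. Let $\theta$ be a smooth $1$-form on $M$ with $\operatorname{Ker}\theta = H(M)$ whose Levi form $G_\theta(X,Y) = (d\theta)(X,JY)$, $X,Y\in H(M)$, is positive definite, where $2\,(d\theta)(X,Y) = X(\theta(Y)) - Y(\theta(X)) - \theta([X,Y])$. Let $T$ be the vector field with $\theta(T)=1$ and $(d\theta)(T,\cdot)=0$; let $\pi_H : T(M)\to H(M)$ be the projection along $\mathbb{R}T$, and set $JT = 0$. Let $g_\theta$ be the Webster metric: $g_\theta = G_\theta$ on $H(M)$, $g_\theta(X,T)=0$ for $X\in H(M)$, $g_\theta(T,T)=1$. For smooth $u$, let $\nabla^H u = \pi_H\nabla u$ be the horizontal part of the $g_\theta$-gradient, and let $\Delta_b u = \operatorname{div}(\nabla^H u)$ be the sublaplacian, with the divergence of the Riemannian metric $g_\theta$. Let $\nabla$ be the Tanaka–Webster connection, i.e. the linear connection for which $H(M)$, $g_\theta$ and $J$ are parallel and whose torsion $T_\nabla$ satisfies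 $T_\nabla(Z,W)=0$ and $T_\nabla(Z,\overline W) = 2i\,G_\theta(Z,\overline W)\,T$ for $Z,W\in T_{1,0}(M) = \{X - iJX : X \in H(M)\}$, and $\tau\circ J + J\circ\tau = 0$, where $\tau(X) = T_\nabla(T,X)$. Let $(\nabla^2 f)(X,Y) = X(Y(f)) - (\nabla_XY)(f)$ be its Hessian, $R(X,Y) = [\nabla_X,\nabla_Y]-\nabla_{[X,Y]}$ its curvature and $\rho(X,Y) = \operatorname{trace}\{Z\mapsto R(Z,Y)X\}$ its Ricci tensor. Then for every real-valued $f\in C^\infty(M)$, $$\tfrac12\,\Delta_b\big(|\nabla^H f|^2\big) = |\pi_H\nabla^2 f|^2 + (\nabla^H f)(\Delta_b f) + \rho(\nabla^H f,\nabla^H f) + 2Lf$$ at every point of $M$, where $|\nabla^H f|^2 = g_\theta(\nabla^H f, \nabla^H f)$, where $|\pi_H\nabla^2 f|^2 = \sum_{j,k=1}^{2n} (\nabla^2 f)(X_j,X_k)^2$ for any $G_\theta$-orthonormal basis $X_1,\dots,X_{2n}$ of $H(M)$ at the point, and where $$Lf = (J\nabla^H f)(Tf) - (J\nabla_T\nabla^H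 f)(f).$$ -/

import Mathlib

open Bundle Manifold VectorField
open scoped ContDiff

noncomputable section

/-- The model space of a manifold of dimension `2 n + 1`. -/
abbrev ModelE (n : ℕ) : Type := EuclideanSpace ℝ (Fin (2 * n + 1))

/-- The tangent space `T_x M` of a manifold of dimension `2 n + 1`. -/
abbrev TanAt (n : ℕ) {M : Type*} [TopologicalSpace M] [ChartedSpace (ModelE n) M] (x : M) : Type :=
  TangentSpace (𝓡 (2 * n + 1)) x

instance tanAt_finiteDimensional (n : ℕ) {M : Type*} [TopologicalSpace M]
    [ChartedSpace (ModelE n) M] (x : M) : FiniteDimensional ℝ (TanAt n x) :=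
  inferInstanceAs (FiniteDimensional ℝ (ModelE n))

section calculus

variable {n : ℕ} {M : Type*} [TopologicalSpace M] [ChartedSpace (ModelE n) M]

/-- The differential of a real function: `dirDeriv f x v = df_x (v) = v (f)`. -/
abbrev dirDeriv (f : M → ℝ) (x : M) : TanAt n x →L[ℝ] ℝ :=
  mvfderiv (𝓡 (2 * n + 1)) f x

/-- The Lie bracket of vector fields. -/
abbrev bracket (X Y : ∀ y : M, TanAt n y) (x : M) : TanAt n x :=
  mlieBracket (𝓡 (2 * n + 1)) X Y x

/-- The operation `(X, Y) ↦ ½ (X(θ(Y)) - Y(θ(X)) - θ([X, Y]))` on vector fields. -/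
def extDerivOp (θ : ∀ x : M, TanAt n x →L[ℝ] ℝ) (x : M) (X Y : ∀ y : M, TanAt n y) : ℝ :=
  (1 / 2) * (dirDeriv (fun y ↦ θ y (Y y)) x (X x) - dirDeriv (fun y ↦ θ y (X y)) x (Y x)
    - θ x (bracket X Y x))

theorem extDerivOp_swap (θ : ∀ x : M, TanAt n x →L[ℝ] ℝ) (x : M) (X Y : ∀ y : M, TanAt n y) :
    extDerivOp θ x X Y = - extDerivOp θ x Y X := by
  simp only [extDerivOp, bracket]
  rw [mlieBracket_swap_apply, map_neg]
  ring

variable [IsManifold (𝓡 (2 * n + 1)) ∞ M]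

/-- The vector field extending `v : T_x M` with constant components in the preferred chart at `x`
(near `x`; it is smooth there). -/
abbrev extendVec {x : M} (v : TanAt n x) : ∀ y : M, TanAt n y :=
  FiberBundle.extend (ModelE n) (E := fun y : M ↦ TangentSpace (𝓡 (2 * n + 1)) y) v

/-- The vector field `X` is of class `C^∞` at `x`. -/
abbrev SmoothFieldAt (X : ∀ y : M, TanAt n y) (x : M) : Prop :=
  ContMDiffAt (𝓡 (2 * n + 1)) ((𝓡 (2 * n + 1)).prod 𝓘(ℝ, ModelE n)) ∞
    (fun y : M ↦ TotalSpace.mk' (ModelE n) (E := TangentSpace (𝓡 (2 * n + 1))) y (X y)) x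

/-- The vector field `X` is differentiable at `x`. -/
abbrev DiffFieldAt (X : ∀ y : M, TanAt n y) (x : M) : Prop :=
  MDifferentiableAt (𝓡 (2 * n + 1)) ((𝓡 (2 * n + 1)).prod 𝓘(ℝ, ModelE n))
    (fun y : M ↦ TotalSpace.mk' (ModelE n) (E := TangentSpace (𝓡 (2 * n + 1))) y (X y)) x

/-- A smooth differential `1`-form: a smooth section of `Hom(TM, ℝ)`. -/
def IsSmoothOneForm (θ : ∀ x : M, TanAt n x →L[ℝ] ℝ) : Prop :=
  ContMDiff (𝓡 (2 * n + 1)) ((𝓡 (2 * n + 1)).prod 𝓘(ℝ, ModelE n →L[ℝ] ℝ)) ∞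
    (fun x : M ↦ TotalSpace.mk' (ModelE n →L[ℝ] ℝ)
      (E := fun x : M ↦ (TangentSpace (𝓡 (2 * n + 1)) x →L[ℝ] Bundle.Trivial M ℝ x)) x (θ x))

theorem IsSmoothOneForm.mdiffAt_apply {θ : ∀ x : M, TanAt n x →L[ℝ] ℝ} (hθ : IsSmoothOneForm θ)
    {X : ∀ y : M, TanAt n y} {x : M} (hX : DiffFieldAt X x) :
    MDifferentiableAt (𝓡 (2 * n + 1)) 𝓘(ℝ, ℝ) (fun y ↦ θ y (X y)) x := by
  have h1 := ((hθ x).mdifferentiableAt (by simp))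
  have := MDifferentiableAt.clm_bundle_apply (F₁ := ModelE n) (F₂ := ℝ)
    (E₁ := fun y : M ↦ TangentSpace (𝓡 (2 * n + 1)) y)
    (E₂ := fun x : M ↦ Bundle.Trivial M ℝ x) (b := fun y : M ↦ y) (ϕ := fun y ↦ θ y)
    (v := fun y ↦ X y) h1 hX
  rw [mdifferentiableAt_totalSpace] at this
  exact this.2

theorem extDerivOp_tensorial_right {θ : ∀ x : M, TanAt n x →L[ℝ] ℝ} (hθ : IsSmoothOneForm θ)
    (x : M) (X : ∀ y : M, TanAt n y) (_hX : DiffFieldAt X x) :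
    TensorialAt (𝓡 (2 * n + 1)) (ModelE n) (fun Y ↦ extDerivOp θ x X Y) x where
  smul {f Y} hf hY := by
    have e1 : (fun y ↦ θ y ((f • Y) y)) = fun y ↦ f y * θ y (Y y) := by
      ext y; simp
    have e2 : bracket X (f • Y) x = _ := mlieBracket_smul_right (V := X) hf hY
    simp only [extDerivOp, e1, e2]
    rw [dirDeriv, mvfderiv_fun_mul hf (hθ.mdiffAt_apply hY)]
    simp
    ring
  add {Y Y'} hY hY' := by
    have e1 : (fun y ↦ θ y ((Y + Y') y)) = fun y ↦ θ y (Y y) + θ y (Y' y) := by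
      ext y; simp
    have e2 : bracket X (Y + Y') x = _ := mlieBracket_add_right (V := X) hY hY'
    simp only [extDerivOp, e1, e2]
    rw [dirDeriv, mvfderiv_fun_add (hθ.mdiffAt_apply hY) (hθ.mdiffAt_apply hY')]
    simp
    ring

theorem extDerivOp_tensorial_left {θ : ∀ x : M, TanAt n x →L[ℝ] ℝ} (hθ : IsSmoothOneForm θ)
    (x : M) (Y : ∀ y : M, TanAt n y) (hY : DiffFieldAt Y x) :
    TensorialAt (𝓡 (2 * n + 1)) (ModelE n) (fun X ↦ extDerivOp θ x X Y) x where
  smul {f X} hf hX := by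
    rw [extDerivOp_swap, (extDerivOp_tensorial_right hθ x Y hY).smul hf hX, extDerivOp_swap θ x X]
    simp
  add {X X'} hX hX' := by
    rw [extDerivOp_swap, (extDerivOp_tensorial_right hθ x Y hY).add hX hX', extDerivOp_swap θ x X,
      extDerivOp_swap θ x X']
    ring

/-- The exterior derivative `dθ` of a smooth `1`-form, normalised (as usual in pseudohermitian
geometry) by `2 (dθ)(X, Y) = X(θ(Y)) - Y(θ(X)) - θ([X, Y])`. -/
def extDerivForm (θ : ∀ x : M, TanAt n x →L[ℝ] ℝ) (hθ : IsSmoothOneForm θ) (x : M) :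
    TanAt n x →L[ℝ] TanAt n x →L[ℝ] ℝ :=
  TensorialAt.mkHom₂ (I := 𝓡 (2 * n + 1)) (F := ModelE n) (F' := ModelE n)
    (extDerivOp θ x) x (fun Y hY ↦ extDerivOp_tensorial_left hθ x Y hY)
    (fun X hX ↦ extDerivOp_tensorial_right hθ x X hX)

theorem extDerivForm_apply {θ : ∀ x : M, TanAt n x →L[ℝ] ℝ} (hθ : IsSmoothOneForm θ) {x : M}
    {X Y : ∀ y : M, TanAt n y} (hX : DiffFieldAt X x) (hY : DiffFieldAt Y x) :
    extDerivForm θ hθ x (X x) (Y x) =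
      (1 / 2) * (dirDeriv (fun y ↦ θ y (Y y)) x (X x) - dirDeriv (fun y ↦ θ y (X y)) x (Y x)
        - θ x (bracket X Y x)) :=
  TensorialAt.mkHom₂_apply _ _ hX hY

theorem extDerivForm_swap {θ : ∀ x : M, TanAt n x →L[ℝ] ℝ} (hθ : IsSmoothOneForm θ) (x : M)
    (u v : TanAt n x) : extDerivForm θ hθ x u v = - extDerivForm θ hθ x v u := by
  unfold extDerivForm
  rw [TensorialAt.mkHom₂_apply_eq_extend, TensorialAt.mkHom₂_apply_eq_extend, extDerivOp_swap]

end calculus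


/-- A CR structure (of hypersurface type) of CR dimension `n` on a manifold `M` of dimension
`2 n + 1`, in its real form: the maximally complex distribution `H(M)`, a smooth subbundle of `TM`
of rank `2 n`, with its complex structure `J`. The corresponding complex bundle is
`T_{1,0}(M) = {X - i J X : X ∈ H(M)}`; the field `integrable` says that the bracket of two sections
`X - i J X`, `Y - i J Y` of `T_{1,0}(M)` is again a section of `T_{1,0}(M)`. -/
structure CRStructure (n : ℕ) (M : Type*) [TopologicalSpace M] [ChartedSpace (ModelE n) M]
    [IsManifold (𝓡 (2 * n + 1)) ∞ M] where
  /-- the maximally complex distribution -/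
  H : ∀ x : M, Submodule ℝ (TanAt n x)
  /-- the complex structure -/
  J : ∀ x : M, H x →ₗ[ℝ] H x
  exists_frame : ∀ x : M, ∃ s : Fin (2 * n) → ∀ y : M, TanAt n y, ∀ᶠ y in nhds x,
    (∀ i, SmoothFieldAt (s i) y) ∧ LinearIndependent ℝ (fun i ↦ s i y) ∧
      Submodule.span ℝ (Set.range fun i ↦ s i y) = H y
  J_smooth : ∀ (x : M) (X : ∀ y : M, H y), SmoothFieldAt (fun y ↦ (X y : TanAt n y)) x →
    SmoothFieldAt (fun y ↦ (J y (X y) : TanAt n y)) x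
  J_sq : ∀ (x : M) (v : H x), J x (J x v) = -v
  integrable : ∀ (x : M) (X Y : ∀ y : M, H y),
    SmoothFieldAt (fun y ↦ (X y : TanAt n y)) x → SmoothFieldAt (fun y ↦ (Y y : TanAt n y)) x →
    ∃ hR : bracket (fun y ↦ (X y : TanAt n y)) (fun y ↦ (Y y : TanAt n y)) x
        - bracket (fun y ↦ (J y (X y) : TanAt n y)) (fun y ↦ (J y (Y y) : TanAt n y)) x ∈ H x,
      bracket (fun y ↦ (J y (X y) : TanAt n y)) (fun y ↦ (Y y : TanAt n y)) x
        + bracket (fun y ↦ (X y : TanAt n y)) (fun y ↦ (J y (Y y) : TanAt n y)) x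
          = (J x ⟨_, hR⟩ : TanAt n x)

/-- A pseudohermitian structure on a CR manifold: a smooth `1`-form `θ` with `Ker θ = H(M)`. -/
structure PseudohermitianStructure {n : ℕ} {M : Type*} [TopologicalSpace M]
    [ChartedSpace (ModelE n) M] [IsManifold (𝓡 (2 * n + 1)) ∞ M] (S : CRStructure n M) where
  θ : ∀ x : M, TanAt n x →L[ℝ] ℝ
  smooth : IsSmoothOneForm θ
  ker_eq : ∀ x : M, (θ x).ker = S.H x

namespace PseudohermitianStructure

variable {n : ℕ} {M : Type*} [TopologicalSpace M]
  [ChartedSpace (ModelE n) M] [IsManifold (𝓡 (2 * n + 1)) ∞ M] {S : CRStructure n M}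

/-- The exterior derivative `dθ`. -/
def dθ (P : PseudohermitianStructure S) (x : M) : TanAt n x →L[ℝ] TanAt n x →L[ℝ] ℝ :=
  extDerivForm P.θ P.smooth x

/-- The Levi form `G_θ(X, Y) = (dθ)(X, J Y)`, `X, Y ∈ H(M)`. -/
def leviForm (P : PseudohermitianStructure S) (x : M) (X Y : S.H x) : ℝ :=
  P.dθ x X (S.J x Y)

end PseudohermitianStructure

/-- A strictly pseudoconvex CR manifold with a contact form `θ` whose Levi form is positive
definite. -/
structure StrictlyPseudoconvexStructure {n : ℕ} {M : Type*} [TopologicalSpace M]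
    [ChartedSpace (ModelE n) M] [IsManifold (𝓡 (2 * n + 1)) ∞ M] (S : CRStructure n M)
    extends PseudohermitianStructure S where
  levi_pos : ∀ (x : M) (X : S.H x), X ≠ 0 → 0 < toPseudohermitianStructure.leviForm x X X

namespace StrictlyPseudoconvexStructure

variable {n : ℕ} {M : Type*} [TopologicalSpace M]
  [ChartedSpace (ModelE n) M] [IsManifold (𝓡 (2 * n + 1)) ∞ M] {S : CRStructure n M}
  (P : StrictlyPseudoconvexStructure S)

theorem dθ_swap (x : M) (u v : TanAt n x) : P.dθ x u v = - P.dθ x v u :=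
  extDerivForm_swap P.smooth x u v

theorem mem_H_iff {x : M} {v : TanAt n x} : v ∈ S.H x ↔ P.θ x v = 0 := by
  rw [← P.ker_eq x]; rfl

theorem exists_theta_eq_one (x : M) : ∃ v : TanAt n x, P.θ x v = 1 := by
  obtain ⟨s, hs⟩ := S.exists_frame x
  obtain ⟨-, hli, hsp⟩ := hs.self_of_nhds
  have h1 : Module.finrank ℝ (S.H x) = 2 * n := by
    rw [← hsp, finrank_span_eq_card hli, Fintype.card_fin]
  have h2 : Module.finrank ℝ (TanAt n x) = 2 * n + 1 :=
    (finrank_euclideanSpace_fin : Module.finrank ℝ (ModelE n) = 2 * n + 1)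
  by_contra! hcon
  have h0 : ∀ v, P.θ x v = 0 := by
    intro v
    by_contra hv
    refine hcon ((P.θ x v)⁻¹ • v) ?_
    simp [hv]
  have : S.H x = ⊤ := by
    ext v
    simp [P.mem_H_iff, h0]
  rw [this, finrank_top] at h1
  omega

theorem exists_reeb (x : M) :
    ∃ t : TanAt n x, P.θ x t = 1 ∧ ∀ v : TanAt n x, P.dθ x t v = 0 := by
  obtain ⟨v₀, hv₀⟩ := P.exists_theta_eq_one x
  let B : TanAt n x →ₗ[ℝ] Module.Dual ℝ (S.H x) :=
    { toFun := fun u ↦ ((P.dθ x u : TanAt n x →L[ℝ] ℝ) : TanAt n x →ₗ[ℝ] ℝ) ∘ₗ (S.H x).subtype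
      map_add' := by intro u v; ext w; simp
      map_smul' := by intro c v; ext w; simp }
  have hinj : Function.Injective (B ∘ₗ (S.H x).subtype) := by
    rw [← LinearMap.ker_eq_bot, LinearMap.ker_eq_bot']
    intro h hh
    by_contra hne
    have h1 := P.levi_pos x h hne
    have h2 : P.dθ x h (S.J x h) = 0 := LinearMap.congr_fun hh (S.J x h)
    exact h1.ne' h2
  have hsurj : Function.Surjective (B ∘ₗ (S.H x).subtype) :=
    (LinearMap.injective_iff_surjective_of_finrank_eq_finrank
      Subspace.dual_finrank_eq.symm).1 hinj
  obtain ⟨h, hh⟩ := hsurj (B v₀)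
  have hθh : P.θ x h = 0 := P.mem_H_iff.1 h.2
  have hw : ∀ w : S.H x, P.dθ x (v₀ - h) w = 0 := by
    intro w
    have : P.dθ x h w = P.dθ x v₀ w := LinearMap.congr_fun hh w
    simp [this]
  have hself : P.dθ x (v₀ - h) (v₀ - h) = 0 := by
    have := P.dθ_swap x (v₀ - h) (v₀ - h)
    linarith
  refine ⟨v₀ - h, by simp [hv₀, hθh], fun v ↦ ?_⟩
  have hv : v - P.θ x v • (v₀ - (h : TanAt n x)) ∈ S.H x := by
    rw [P.mem_H_iff]; simp [hv₀, hθh]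
  have h3 := hw ⟨_, hv⟩
  rw [map_sub, map_smul, hself] at h3
  simpa using h3

/-- The characteristic direction `T`: `θ(T) = 1`, `T ⌟ dθ = 0`. -/
def reeb (x : M) : TanAt n x := Classical.choose (P.exists_reeb x)

theorem theta_reeb (x : M) : P.θ x (P.reeb x) = 1 := (Classical.choose_spec (P.exists_reeb x)).1

theorem dθ_reeb (x : M) (v : TanAt n x) : P.dθ x (P.reeb x) v = 0 :=
  (Classical.choose_spec (P.exists_reeb x)).2 v

/-- The conditions `θ(T) = 1` and `T ⌟ dθ = 0` determine `T`. -/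
theorem reeb_unique {x : M} {t : TanAt n x} (h1 : P.θ x t = 1)
    (h2 : ∀ v : TanAt n x, P.dθ x t v = 0) : t = P.reeb x := by
  have hm : t - P.reeb x ∈ S.H x := by rw [P.mem_H_iff]; simp [h1, P.theta_reeb]
  by_contra hne
  have hpos := P.levi_pos x ⟨_, hm⟩ (by simpa [Subtype.ext_iff, sub_eq_zero] using hne)
  simp [PseudohermitianStructure.leviForm, h2, P.dθ_reeb] at hpos

/-- The projection `π_H : T(M) → H(M)` along `ℝ T`. -/
def projH (x : M) : TanAt n x →ₗ[ℝ] S.H x :=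
  LinearMap.codRestrict (S.H x)
    (LinearMap.id - ((P.θ x : TanAt n x →L[ℝ] ℝ) : TanAt n x →ₗ[ℝ] ℝ).smulRight (P.reeb x))
    (fun v ↦ by rw [P.mem_H_iff]; simp [P.theta_reeb])

theorem projH_apply (x : M) (v : TanAt n x) :
    (P.projH x v : TanAt n x) = v - P.θ x v • P.reeb x := rfl

/-- The complex structure `J` extended to `T(M)` by `J T = 0`. -/
def Jext (x : M) : TanAt n x →ₗ[ℝ] TanAt n x :=
  (S.H x).subtype ∘ₗ S.J x ∘ₗ P.projH x

/-- The Webster metric: `g_θ = G_θ` on `H(M)`, `g_θ(X, T) = 0` for `X ∈ H(M)`, `g_θ(T, T) = 1`. -/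
def webster (x : M) : LinearMap.BilinForm ℝ (TanAt n x) :=
  LinearMap.mk₂ ℝ
    (fun u v ↦ P.leviForm x (P.projH x u) (P.projH x v) + P.θ x u * P.θ x v)
    (by intro u u' v; simp [PseudohermitianStructure.leviForm]; ring)
    (by intro c u v; simp [PseudohermitianStructure.leviForm]; ring)
    (by intro u v v'; simp [PseudohermitianStructure.leviForm]; ring)
    (by intro c u v; simp [PseudohermitianStructure.leviForm]; ring)

theorem webster_apply (x : M) (u v : TanAt n x) : P.webster x u v =
    P.leviForm x (P.projH x u) (P.projH x v) + P.θ x u * P.θ x v := rfl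

theorem webster_pos (x : M) (v : TanAt n x) (hv : v ≠ 0) : 0 < P.webster x v v := by
  rw [webster_apply]
  by_cases h : P.projH x v = 0
  · have h1 : v = P.θ x v • P.reeb x := by
      have := congrArg Subtype.val h
      rw [projH_apply] at this
      exact sub_eq_zero.1 this
    have h2 : P.θ x v ≠ 0 := by
      intro h0; rw [h0, zero_smul] at h1; exact hv h1
    rw [h]
    have : P.leviForm x 0 0 = 0 := by simp [PseudohermitianStructure.leviForm]
    rw [this, zero_add]
    exact mul_self_pos.2 h2
  · exact add_pos_of_pos_of_nonneg (P.levi_pos x _ h) (mul_self_nonneg _)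

theorem webster_nondegenerate (x : M) : (P.webster x).Nondegenerate := by
  constructor
  · intro v hv
    by_contra hne
    exact (P.webster_pos x v hne).ne' (hv v)
  · intro v hv
    by_contra hne
    exact (P.webster_pos x v hne).ne' (hv v)

/-- The gradient `∇f`: `g_θ(∇f, X) = X(f)` for all `X`. -/
def grad (f : M → ℝ) (x : M) : TanAt n x :=
  ((P.webster x).toDual (P.webster_nondegenerate x)).symm
    (dirDeriv (n := n) f x).toLinearMap

theorem webster_grad (f : M → ℝ) (x : M) (v : TanAt n x) :
    P.webster x (P.grad f x) v = dirDeriv f x v :=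
  LinearMap.BilinForm.apply_toDual_symm_apply (B := P.webster x)
    (hB := P.webster_nondegenerate x) _ v

/-- The horizontal gradient `∇^H f = π_H ∇f`. -/
def gradH (f : M → ℝ) (x : M) : TanAt n x := P.projH x (P.grad f x)

end StrictlyPseudoconvexStructure

/-- The divergence of a vector field `X` with respect to a Riemannian metric `g`: in the preferred
chart at `x`, `div X = (1 / √det g) ∑ i, ∂_i (√det g X^i)`. -/
def divergence {n : ℕ} {M : Type*} [TopologicalSpace M] [ChartedSpace (ModelE n) M]
    (g : ∀ x : M, LinearMap.BilinForm ℝ (TanAt n x)) (X : ∀ x : M, TanAt n x) (x : M) : ℝ :=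
  let φ := extChartAt (𝓡 (2 * n + 1)) x
  let e : Fin (2 * n + 1) → ModelE n := fun i ↦ EuclideanSpace.single i 1
  let coordVec (z : ModelE n) (i : Fin (2 * n + 1)) : TanAt n (φ.symm z) :=
    mfderiv 𝓘(ℝ, ModelE n) (𝓡 (2 * n + 1)) φ.symm z (e i)
  let density (z : ModelE n) : ℝ :=
    √(Matrix.det (Matrix.of fun i j ↦ g (φ.symm z) (coordVec z i) (coordVec z j)))
  let component (z : ModelE n) : ModelE n :=
    mfderiv (𝓡 (2 * n + 1)) 𝓘(ℝ, ModelE n) φ (φ.symm z) (X (φ.symm z))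
  (1 / density (φ x)) * ∑ i, fderiv ℝ (fun z ↦ density z * component z i) (φ x) (e i)

/-- Linear connections on `M` (`cov Y x v` is `(∇_v Y)(x)`). -/
abbrev LinearConnection (n : ℕ) (M : Type*) [TopologicalSpace M] [ChartedSpace (ModelE n) M]
    [IsManifold (𝓡 (2 * n + 1)) ∞ M] : Type _ :=
  CovariantDerivative (𝓡 (2 * n + 1)) (ModelE n) (TangentSpace (𝓡 (2 * n + 1)) : M → Type _)

namespace LinearConnection

variable {n : ℕ} {M : Type*} [TopologicalSpace M]
  [ChartedSpace (ModelE n) M] [IsManifold (𝓡 (2 * n + 1)) ∞ M]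

/-- The Hessian `(∇²f)(X, Y) = (∇_X df) Y = X(Y(f)) - (∇_X Y) f`. -/
def hessian (cov : LinearConnection n M) (f : M → ℝ) (x : M) (u v : TanAt n x) : ℝ :=
  dirDeriv (fun y ↦ dirDeriv f y (extendVec v y)) x u - dirDeriv f x (cov (extendVec v) x u)

/-- The curvature `R(X, Y) Z = ∇_X ∇_Y Z - ∇_Y ∇_X Z - ∇_{[X, Y]} Z`. -/
def curvature (cov : LinearConnection n M) (x : M) (u v w : TanAt n x) : TanAt n x :=
  cov (fun y ↦ cov (extendVec w) y (extendVec v y)) x u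
    - cov (fun y ↦ cov (extendVec w) y (extendVec u y)) x v
    - cov (extendVec w) x (bracket (extendVec u) (extendVec v) x)

/-- The Ricci tensor `ρ(X, Y) = trace {Z ↦ R(Z, Y) X}`. -/
def ricci (cov : LinearConnection n M) (x : M) (u v : TanAt n x) : ℝ :=
  let b := Module.finBasis ℝ (TanAt n x)
  ∑ i, b.repr (cov.curvature x (b i) v u) i

end LinearConnection

/-- The `ℂ`-bilinear extension of a bilinear map `B : V × V → W` to the complexifications; the pair
`(a, b)` stands for `a + i b`. -/
def complexExt {V W : Type*} [AddCommGroup W] (B : V → V → W) (z w : V × V) : W × W :=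
  (B z.1 w.1 - B z.2 w.2, B z.1 w.2 + B z.2 w.1)

namespace StrictlyPseudoconvexStructure

variable {n : ℕ} {M : Type*} [TopologicalSpace M]
  [ChartedSpace (ModelE n) M] [IsManifold (𝓡 (2 * n + 1)) ∞ M] {S : CRStructure n M}
  (P : StrictlyPseudoconvexStructure S)

/-- The sublaplacian `Δ_b f = div (∇^H f)`. -/
def sublaplacian (f : M → ℝ) (x : M) : ℝ := divergence P.webster (P.gradH f) x

/-- The element `X - i J X` of `T_{1,0}(M)`, as a pair of real vectors. -/
def holVec {x : M} (X : S.H x) : TanAt n x × TanAt n x := (X, -(S.J x X : TanAt n x))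

/-- The element `X + i J X` of `T_{0,1}(M)`, as a pair of real vectors. -/
def antiholVec {x : M} (X : S.H x) : TanAt n x × TanAt n x := (X, S.J x X)

/-- `cov` is the Tanaka-Webster connection of `(M, θ)`. -/
structure IsTanakaWebster (cov : LinearConnection n M) : Prop where
  /-- `∇` is a smooth connection -/
  smooth : CovariantDerivative.ContMDiffCovariantDerivative cov ∞
  /-- `H(M)` is parallel -/
  parallel_H : ∀ (x : M) (Y : ∀ y : M, S.H y), DiffFieldAt (fun y ↦ (Y y : TanAt n y)) x →
    ∀ v : TanAt n x, cov (fun y ↦ (Y y : TanAt n y)) x v ∈ S.H x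
  /-- `∇ g_θ = 0` -/
  parallel_g : ∀ (x : M) (Y Z : ∀ y : M, TanAt n y), DiffFieldAt Y x → DiffFieldAt Z x →
    ∀ v : TanAt n x, dirDeriv (fun y ↦ P.webster y (Y y) (Z y)) x v
      = P.webster x (cov Y x v) (Z x) + P.webster x (Y x) (cov Z x v)
  /-- `∇ J = 0` -/
  parallel_J : ∀ (x : M) (Y : ∀ y : M, S.H y), DiffFieldAt (fun y ↦ (Y y : TanAt n y)) x →
    ∀ v : TanAt n x, cov (fun y ↦ (S.J y (Y y) : TanAt n y)) x v
      = P.Jext x (cov (fun y ↦ (Y y : TanAt n y)) x v)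
  /-- `T_∇(Z, W) = 0` for `Z, W ∈ T_{1,0}(M)` -/
  torsion_hol : ∀ (x : M) (X Y : S.H x),
    complexExt (fun u v : TanAt n x ↦ cov.torsion x u v) (holVec X) (holVec Y) = 0
  /-- `T_∇(Z, W̄) = 2 i G_θ(Z, W̄) T` for `Z, W ∈ T_{1,0}(M)` -/
  torsion_mixed : ∀ (x : M) (X Y : S.H x),
    complexExt (fun u v : TanAt n x ↦ cov.torsion x u v) (holVec X) (antiholVec Y)
      = let c := complexExt (fun u v : TanAt n x ↦ P.webster x u v) (holVec X) (antiholVec Y)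
        ((-(2 * c.2)) • P.reeb x, (2 * c.1) • P.reeb x)
  /-- `τ ∘ J + J ∘ τ = 0`, where `τ(X) = T_∇(T, X)` -/
  torsion_J : ∀ (x : M) (v : TanAt n x),
    cov.torsion x (P.reeb x) (P.Jext x v) + P.Jext x (cov.torsion x (P.reeb x) v) = 0

/-- The operator `L f = (J ∇^H f)(T f) - (J ∇_T ∇^H f)(f)`. -/
def opL (cov : LinearConnection n M) (f : M → ℝ) (x : M) : ℝ :=
  dirDeriv (fun y ↦ dirDeriv f y (P.reeb y)) x (P.Jext x (P.gradH f x))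
    - dirDeriv f x (P.Jext x (cov (P.gradH f) x (P.reeb x)))

/-- `(X_1, …, X_{2n})` is a `G_θ`-orthonormal frame of `H(M)_x`. -/
def IsOrthonormalFrameH (x : M) (X : Fin (2 * n) → TanAt n x) : Prop :=
  (∀ j, X j ∈ S.H x) ∧ ∀ j k, P.webster x (X j) (X k) = if j = k then 1 else 0

end StrictlyPseudoconvexStructure

end

/-! Write `Y` for the horizontal gradient of `f`, `A = ∇Y` as an endomorphism of the tangent space,
and `T` for the characteristic direction. The proof takes a trace of second covariant derivatives,
as in the Riemannian Bochner formula, and keeps track of the torsion.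

For any metric connection, `div X` is the trace of `∇X` plus the trace of the torsion operator
`T_∇(X, ·)` (`divergence_eq_trace`). For the Tanaka-Webster connection and horizontal `X` the second
trace is zero (`trace_torsion`), so `Δ_b u = tr ∇(∇^H u)`.

The horizontal Hessian is `g_θ(A u, v)`. Its antisymmetric part is torsion: exchanging `u` and `v`
costs `2 g_θ(u, Jv) Tf`. Since `v(|Y|²) = 2 Hess(v, Y)`, half the horizontal gradient of `|Y|²` is
`∇_Y Y + 2 (Tf) JY` (`gradH_sq`). The left side of the formula is the trace of the covariant
derivative of this field.

The first term is handled by commuting derivatives (`trace_cov_cov`): `tr ∇(∇_Y Y) = ρ(Y, Y) + Y(tr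
A) + tr A² + tr(A ∘ T_∇(Y, ·))`. Here `tr A = Δ_b f`. The last trace is `-2 (J ∇_T Y) f`
(`trace_comp_torsion`). The asymmetry of the Hessian gives `tr A² = |π_H ∇²f|² - 2 (Tf) tr(JA)`
(`trace_cov_gradH_sq`).

As `J` is parallel, the second term has trace `2 (Tf) tr(JA) + 2 (JY)(Tf)` (`trace_cov_smul_Jext`).
The two multiples of `tr(JA)` cancel, and what remains besides the Hessian, Ricci and `Y(Δ_b f)`
terms is `2 Lf`. -/

open scoped Topology

noncomputable section

/-! ### Smooth functions, vector fields and brackets, read in charts. -/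

section calculus
variable {n : ℕ} {M : Type*} [TopologicalSpace M] [ChartedSpace (ModelE n) M]
  [IsManifold (𝓡 (2 * n + 1)) ∞ M]

/-- The real function `f` is of class `C^∞` at `x`. -/
abbrev SmoothFnAt (f : M → ℝ) (x : M) : Prop := ContMDiffAt (𝓡 (2 * n + 1)) 𝓘(ℝ, ℝ) ∞ f x

/-- The real function `f` is differentiable at `x`. -/
abbrev DiffFnAt (f : M → ℝ) (x : M) : Prop := MDifferentiableAt (𝓡 (2 * n + 1)) 𝓘(ℝ, ℝ) f x

omit [IsManifold (𝓡 (2 * n + 1)) ∞ M] in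
theorem SmoothFnAt.diff {f : M → ℝ} {x : M} (hf : SmoothFnAt (n := n) f x) :
    DiffFnAt (n := n) f x :=
  hf.mdifferentiableAt (by simp)

theorem SmoothFieldAt.diff {X : ∀ y : M, TanAt n y} {x : M} (hX : SmoothFieldAt X x) :
    DiffFieldAt X x :=
  hX.mdifferentiableAt (by simp)

theorem SmoothFieldAt.eventually_diff {X : ∀ y : M, TanAt n y} {x : M} (hX : SmoothFieldAt X x) :
    ∀ᶠ y in 𝓝 x, DiffFieldAt X y := by
  have h : ContMDiffAt _ _ 1 _ x := hX.of_le (by simp)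
  filter_upwards [(contMDiffAt_iff_contMDiffAt_nhds (by simp)).1 h] with y hy
  exact hy.mdifferentiableAt (by simp)

theorem SmoothFnAt.eventually_diff {f : M → ℝ} {x : M} (hX : SmoothFnAt (n := n) f x) :
    ∀ᶠ y in 𝓝 x, DiffFnAt (n := n) f y := by
  have h : ContMDiffAt _ _ 1 _ x := hX.of_le (by simp)
  filter_upwards [(contMDiffAt_iff_contMDiffAt_nhds (by simp)).1 h] with y hy
  exact hy.mdifferentiableAt (by simp)

theorem SmoothFnAt.dirDeriv {f : M → ℝ} {X : ∀ y : M, TanAt n y} {x : M}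
    (hf : SmoothFnAt (n := n) f x) (hX : SmoothFieldAt X x) :
    SmoothFnAt (n := n) (fun y ↦ dirDeriv f y (X y)) x := by
  have h1 := hf.mfderiv_const (m := ∞) (by simp)
  have := ContMDiffAt.clm_apply_of_inCoordinates (n := ∞) (F₁ := ModelE n) (F₂ := ℝ)
    (E₁ := fun y : M ↦ TangentSpace (𝓡 (2 * n + 1)) y)
    (E₂ := fun y : ℝ ↦ TangentSpace 𝓘(ℝ, ℝ) y) (b₁ := fun y : M ↦ y) (b₂ := f)
    (ϕ := fun y ↦ mfderiv (𝓡 (2 * n + 1)) 𝓘(ℝ, ℝ) f y) (v := X) h1 hX hf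
  rw [contMDiffAt_totalSpace] at this
  simpa using! this.2

theorem SmoothFieldAt.bracket {X Y : ∀ y : M, TanAt n y} {x : M}
    (hX : SmoothFieldAt X x) (hY : SmoothFieldAt Y x) :
    SmoothFieldAt (bracket X Y) x :=
  haveI : IsManifold (𝓡 (2 * n + 1)) (minSmoothness ℝ 2) M := by
    simpa using (inferInstance : IsManifold (𝓡 (2 * n + 1)) 2 M)
  haveI : IsManifold (𝓡 (2 * n + 1)) (((⊤ : ℕ∞) : ℕ∞ω) + 1) M := by simpa
  ContMDiffAt.mlieBracket_vectorField (n := ⊤) (m := ⊤) hX hY (by simp)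

theorem SmoothFieldAt.smul {f : M → ℝ} {X : ∀ y : M, TanAt n y} {x : M}
    (hf : SmoothFnAt (n := n) f x) (hX : SmoothFieldAt X x) : SmoothFieldAt (f • X) x :=
  ContMDiffAt.smul_section hf hX

theorem SmoothFieldAt.add {X Y : ∀ y : M, TanAt n y} {x : M}
    (hX : SmoothFieldAt X x) (hY : SmoothFieldAt Y x) : SmoothFieldAt (X + Y) x :=
  ContMDiffAt.add_section hX hY

theorem SmoothFieldAt.sub {X Y : ∀ y : M, TanAt n y} {x : M}
    (hX : SmoothFieldAt X x) (hY : SmoothFieldAt Y x) : SmoothFieldAt (X - Y) x :=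
  ContMDiffAt.sub_section hX hY

theorem SmoothFieldAt.sum {ι : Type*} {s : Finset ι} {X : ι → ∀ y : M, TanAt n y} {x : M}
    (hX : ∀ i ∈ s, SmoothFieldAt (X i) x) : SmoothFieldAt (fun y ↦ ∑ i ∈ s, X i y) x :=
  ContMDiffAt.sum_section hX

theorem SmoothFieldAt.congr {X Y : ∀ y : M, TanAt n y} {x : M}
    (hX : SmoothFieldAt X x) (h : ∀ᶠ y in 𝓝 x, Y y = X y) : SmoothFieldAt Y x :=
  ContMDiffAt.congr_of_eventuallyEq hX (by filter_upwards [h] with y hy; rw [hy])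

theorem smoothFieldAt_extendVec {x : M} (v : TanAt n x) : SmoothFieldAt (extendVec v) x :=
  FiberBundle.contMDiffAt_extend _ _ v

omit [IsManifold (𝓡 (2 * n + 1)) ∞ M] in
theorem dirDeriv_congr {f g : M → ℝ} {x : M} (h : f =ᶠ[𝓝 x] g) :
    dirDeriv (n := n) f x = dirDeriv g x := by
  unfold dirDeriv mvfderiv
  rw [h.mfderiv_eq (I := 𝓡 (2 * n + 1))]
  rfl

theorem dirDeriv_comp_symm {a : M → ℝ} {x : M} {z : ModelE n}
    (hz : z ∈ (extChartAt (𝓡 (2 * n + 1)) x).target)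
    (ha : DiffFnAt (n := n) a ((extChartAt (𝓡 (2 * n + 1)) x).symm z)) (v : ModelE n) :
    fderiv ℝ (a ∘ (extChartAt (𝓡 (2 * n + 1)) x).symm) z v
      = dirDeriv a ((extChartAt (𝓡 (2 * n + 1)) x).symm z)
        (mfderiv 𝓘(ℝ, ModelE n) (𝓡 (2 * n + 1)) (extChartAt (𝓡 (2 * n + 1)) x).symm z v) := by
  have h1 : MDifferentiableAt 𝓘(ℝ, ModelE n) (𝓡 (2 * n + 1))
      (extChartAt (𝓡 (2 * n + 1)) x).symm z := by
    have := mdifferentiableWithinAt_extChartAt_symm (I := 𝓡 (2 * n + 1)) hz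
    simpa [mdifferentiableWithinAt_univ] using this
  rw [← mfderiv_eq_fderiv, mfderiv_comp z ha h1]
  rfl
theorem mfderiv_extChartAt_symm_self (x : M) :
    mfderiv 𝓘(ℝ, ModelE n) (𝓡 (2 * n + 1)) (extChartAt (𝓡 (2 * n + 1)) x).symm
      (extChartAt (𝓡 (2 * n + 1)) x x) = ContinuousLinearMap.id ℝ _ := by
  have := mfderivWithin_range_extChartAt_symm (I := 𝓡 (2 * n + 1)) (x := x)
  simpa [mfderivWithin_univ] using! this

theorem dirDeriv_eq_fderiv {a : M → ℝ} {x : M} (ha : DiffFnAt (n := n) a x) (v : TanAt n x) :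
    dirDeriv a x v = fderiv ℝ (a ∘ (extChartAt (𝓡 (2 * n + 1)) x).symm)
      (extChartAt (𝓡 (2 * n + 1)) x x) v := by
  have hb : (extChartAt (𝓡 (2 * n + 1)) x).symm (extChartAt (𝓡 (2 * n + 1)) x x) = x :=
    extChartAt_to_inv x
  have h := dirDeriv_comp_symm (n := n) (a := a) (x := x) (z := extChartAt (𝓡 (2 * n + 1)) x x)
    (mem_extChartAt_target x) (by rwa [hb]) v
  rw [h, mfderiv_extChartAt_symm_self, hb]
  rfl

/-- The vector field `V` read in the preferred chart at `x`. -/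
def chartField (x : M) (V : ∀ y : M, TanAt n y) (z : ModelE n) : ModelE n :=
  mpullbackWithin 𝓘(ℝ, ModelE n) (𝓡 (2 * n + 1)) (extChartAt (𝓡 (2 * n + 1)) x).symm V
    (Set.range (𝓡 (2 * n + 1))) z

theorem mfderiv_symm_chartField {x : M} (V : ∀ y : M, TanAt n y) {z : ModelE n}
    (hz : z ∈ (extChartAt (𝓡 (2 * n + 1)) x).target) :
    mfderiv 𝓘(ℝ, ModelE n) (𝓡 (2 * n + 1)) (extChartAt (𝓡 (2 * n + 1)) x).symm z
      (chartField x V z) = V ((extChartAt (𝓡 (2 * n + 1)) x).symm z) := by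
  have h := isInvertible_mfderivWithin_extChartAt_symm (I := 𝓡 (2 * n + 1)) hz
  have h2 := h.self_comp_inverse
  have h3 := congrArg (fun L ↦ L (V ((extChartAt (𝓡 (2 * n + 1)) x).symm z))) h2
  simpa [mfderivWithin_univ, chartField, mpullbackWithin_apply] using! h3

/-- The preferred chart at `x` has identity differential at `x`, so no transport of the Euclidean
bracket is needed at the base point. -/
theorem bracket_eq_lieBracket (U V : ∀ y : M, TanAt n y) (x : M) :
    bracket U V x = lieBracket ℝ (chartField x U) (chartField x V)
      (extChartAt (𝓡 (2 * n + 1)) x x) := by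
  unfold bracket
  rw [← mlieBracketWithin_univ, mlieBracketWithin_apply, mfderiv_extChartAt_self]
  have h : ∀ w : ModelE n, (ContinuousLinearMap.id ℝ (ModelE n)).inverse w = w := by
    intro w; rw [ContinuousLinearMap.inverse_id]; rfl
  refine (h _).trans ?_
  have hs : (extChartAt (𝓡 (2 * n + 1)) x).symm ⁻¹' Set.univ ∩ Set.range (𝓡 (2 * n + 1))
      = Set.univ := by simp
  change lieBracketWithin ℝ (chartField x U) (chartField x V) ((extChartAt (𝓡 (2 * n + 1)) x).symm
    ⁻¹' Set.univ ∩ Set.range (𝓡 (2 * n + 1))) _ = _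
  rw [hs, lieBracketWithin_univ]

theorem DiffFieldAt.chartField {V : ∀ y : M, TanAt n y} {x : M} (hV : DiffFieldAt V x) :
    DifferentiableAt ℝ (chartField x V) (extChartAt (𝓡 (2 * n + 1)) x x) := by
  have := (mdifferentiableWithinAt_univ.2 hV).differentiableWithinAt_mpullbackWithin_vectorField
  have hs : (extChartAt (𝓡 (2 * n + 1)) x).symm ⁻¹' Set.univ ∩ Set.range (𝓡 (2 * n + 1))
      = Set.univ := by simp
  rw [hs] at this
  exact differentiableWithinAt_univ.1 this

omit [IsManifold (𝓡 (2 * n + 1)) ∞ M] in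
theorem eventually_extChartAt_target (x : M) :
    ∀ᶠ z in 𝓝 (extChartAt (𝓡 (2 * n + 1)) x x), z ∈ (extChartAt (𝓡 (2 * n + 1)) x).target :=
  extChartAt_target_mem_nhds x

omit [IsManifold (𝓡 (2 * n + 1)) ∞ M] in
theorem tendsto_extChartAt_symm (x : M) :
    Filter.Tendsto (extChartAt (𝓡 (2 * n + 1)) x).symm (𝓝 (extChartAt (𝓡 (2 * n + 1)) x x))
      (𝓝 x) := by
  have := continuousAt_extChartAt_symm (I := 𝓡 (2 * n + 1)) x
  simpa [ContinuousAt] using! this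

/-- In a chart this is the symmetry of the second derivative of `a`. It turns differences of
iterated derivatives into brackets for both the curvature and the Hessian. -/
theorem dirDeriv_bracket {a : M → ℝ} {U V : ∀ y : M, TanAt n y} {x : M}
    (ha : SmoothFnAt (n := n) a x) (hU : SmoothFieldAt U x) (hV : SmoothFieldAt V x) :
    dirDeriv a x (bracket U V x) = dirDeriv (fun y ↦ dirDeriv a y (V y)) x (U x)
      - dirDeriv (fun y ↦ dirDeriv a y (U y)) x (V x) := by
  have key : ∀ W : ∀ y : M, TanAt n y, ∀ᶠ z in 𝓝 (extChartAt (𝓡 (2 * n + 1)) x x),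
      fderiv ℝ (a ∘ (extChartAt (𝓡 (2 * n + 1)) x).symm) z (chartField x W z)
        = ((fun y ↦ dirDeriv a y (W y)) ∘ (extChartAt (𝓡 (2 * n + 1)) x).symm) z := by
    intro W
    filter_upwards [eventually_extChartAt_target x,
      (tendsto_extChartAt_symm x).eventually ha.eventually_diff] with z hz hd
    rw [dirDeriv_comp_symm hz hd, mfderiv_symm_chartField W hz]
    rfl
  have key2 : ∀ W : ∀ y : M, TanAt n y,
      chartField x W (extChartAt (𝓡 (2 * n + 1)) x x) = W x := by
    intro W
    have h := mfderiv_symm_chartField W (mem_extChartAt_target (I := 𝓡 (2 * n + 1)) x)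
    rw [mfderiv_extChartAt_symm_self, extChartAt_to_inv] at h
    exact h
  have ha2 : ContDiffAt ℝ ∞ (a ∘ (extChartAt (𝓡 (2 * n + 1)) x).symm)
      (extChartAt (𝓡 (2 * n + 1)) x x) := by
    have := (contMDiffAt_iff.1 ha).2
    simpa [contDiffWithinAt_univ] using! this
  rw [dirDeriv_eq_fderiv ha.diff, dirDeriv_eq_fderiv (ha.dirDeriv hV).diff,
    dirDeriv_eq_fderiv (ha.dirDeriv hU).diff, bracket_eq_lieBracket,
    fderiv_apply_lieBracket ha2 (by simp [ENat.LEInfty.out]) hV.diff.chartField hU.diff.chartField,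
    Filter.EventuallyEq.fderiv_eq (key V), Filter.EventuallyEq.fderiv_eq (key U), key2, key2]

/-! ### The coordinate frame of a chart. -/

/-- The `i`-th coordinate vector field of the preferred chart at `x`. -/
def coordField (x : M) (i : Fin (2 * n + 1)) (y : M) : TanAt n y :=
  (trivializationAt (ModelE n) (TangentSpace (𝓡 (2 * n + 1))) x).symmL ℝ y
    (EuclideanSpace.single i 1)

/-- The `i`-th component of a tangent vector in the preferred chart at `x`. -/
def coordCoef (x : M) (i : Fin (2 * n + 1)) (y : M) : TanAt n y →ₗ[ℝ] ℝ :=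
  (EuclideanSpace.proj i : ModelE n →L[ℝ] ℝ).toLinearMap ∘ₗ
  ((trivializationAt (ModelE n) (TangentSpace (𝓡 (2 * n + 1))) x).continuousLinearMapAt ℝ
    y).toLinearMap

theorem coordCoef_coordField {x y : M} (hy : y ∈ (chartAt (ModelE n) x).source)
    (i j : Fin (2 * n + 1)) :
    coordCoef x i y (coordField x j y) = if i = j then 1 else 0 := by
  have h : y ∈ (trivializationAt (ModelE n) (TangentSpace (𝓡 (2 * n + 1))) x).baseSet := by
    simpa using hy
  simp only [coordCoef, coordField, LinearMap.comp_apply, ContinuousLinearMap.coe_coe]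
  rw [Trivialization.continuousLinearMapAt_symmL _ h]
  simp

theorem sum_coordCoef_smul {x y : M} (hy : y ∈ (chartAt (ModelE n) x).source) (v : TanAt n y) :
    ∑ i, coordCoef x i y v • coordField x i y = v := by
  have h : y ∈ (trivializationAt (ModelE n) (TangentSpace (𝓡 (2 * n + 1))) x).baseSet := by
    simpa using hy
  simp only [coordField, ← map_smul, ← map_sum]
  conv_rhs => rw [← Trivialization.symmL_continuousLinearMapAt (R := ℝ) _ h v]
  congr 1
  ext j
  simp [coordCoef, Pi.single_apply]

omit [IsManifold (𝓡 (2 * n + 1)) ∞ M] in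
theorem eventually_chart_source (x : M) : ∀ᶠ y in 𝓝 x, y ∈ (chartAt (ModelE n) x).source :=
  (chartAt (ModelE n) x).open_source.mem_nhds (mem_chart_source _ x)

theorem eventually_sum_coordCoef_smul (x : M) (X : ∀ y : M, TanAt n y) :
    ∀ᶠ y in 𝓝 x, X y = ∑ i, coordCoef x i y (X y) • coordField x i y := by
  filter_upwards [eventually_chart_source (n := n) x] with y hy
  rw [sum_coordCoef_smul hy]

theorem smoothFieldAt_coordField {x y : M} (hy : y ∈ (chartAt (ModelE n) x).source)
    (i : Fin (2 * n + 1)) : SmoothFieldAt (coordField x i) y := by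
  have h : y ∈ (trivializationAt (ModelE n) (TangentSpace (𝓡 (2 * n + 1))) x).baseSet := by
    simpa using hy
  refine (contMDiffAt_localFrame_of_mem (I := 𝓡 (2 * n + 1)) ∞ _
    (EuclideanSpace.basisFun (Fin (2 * n + 1)) ℝ).toBasis i h).congr_of_eventuallyEq ?_
  filter_upwards [(chartAt (ModelE n) x).open_source.mem_nhds hy] with z hz
  have hz' : z ∈ (trivializationAt (ModelE n) (TangentSpace (𝓡 (2 * n + 1))) x).baseSet := by
    simpa using hz
  rw [Trivialization.localFrame_apply_of_mem_baseSet _ _ hz']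
  simp [coordField, Trivialization.basisAt, Trivialization.symmL_apply _ hz']

theorem smoothFnAt_coordCoef {x : M} {X : ∀ y : M, TanAt n y} (hX : SmoothFieldAt X x)
    (i : Fin (2 * n + 1)) : SmoothFnAt (n := n) (fun y ↦ coordCoef x i y (X y)) x := by
  have h : x ∈ (trivializationAt (ModelE n) (TangentSpace (𝓡 (2 * n + 1))) x).baseSet := by
    simp
  have h1 := (Trivialization.contMDiffAt_section_iff (IB := 𝓡 (2 * n + 1)) _ h).1 hX
  have h2 : ContMDiffAt (𝓡 (2 * n + 1)) 𝓘(ℝ, ℝ) ∞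
      (fun y ↦ (EuclideanSpace.proj i : ModelE n →L[ℝ] ℝ)
    ((trivializationAt (ModelE n) (TangentSpace (𝓡 (2 * n + 1))) x) ⟨y, X y⟩).2) x :=
    (EuclideanSpace.proj i : ModelE n →L[ℝ] ℝ).contMDiff.contMDiffAt.comp x h1
  refine h2.congr_of_eventuallyEq ?_
  filter_upwards [eventually_chart_source (n := n) x] with y hy
  simp only [coordCoef, LinearMap.comp_apply, ContinuousLinearMap.coe_coe]
  rw [Trivialization.continuousLinearMapAt_apply, Trivialization.linearMapAt_apply, if_pos]
  simpa using hy

theorem chartField_coordField {x : M} {z : ModelE n}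
    (hz : z ∈ (extChartAt (𝓡 (2 * n + 1)) x).target) (i : Fin (2 * n + 1)) :
    chartField x (coordField x i) z = EuclideanSpace.single i 1 := by
  have h := isInvertible_mfderivWithin_extChartAt_symm (I := 𝓡 (2 * n + 1)) hz
  have h3 := congrArg (fun L ↦ L (EuclideanSpace.single i (1 : ℝ))) h.inverse_comp_self
  have hy : (extChartAt (𝓡 (2 * n + 1)) x).symm z ∈ (chartAt (ModelE n) x).source := by
    simpa using (extChartAt (𝓡 (2 * n + 1)) x).map_target hz
  rw [chartField, mpullbackWithin_apply, coordField, TangentBundle.symmL_trivializationAt hy,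
    (extChartAt (𝓡 (2 * n + 1)) x).right_inv hz]
  exact h3

/-- Coordinate fields are constant when read in their own chart. -/
theorem bracket_coordField (x : M) (i j : Fin (2 * n + 1)) :
    bracket (coordField x i) (coordField x j) x = 0 := by
  rw [bracket_eq_lieBracket]
  have h : ∀ i, chartField x (coordField x i) =ᶠ[𝓝 (extChartAt (𝓡 (2 * n + 1)) x x)]
      fun _ ↦ EuclideanSpace.single i 1 := by
    intro i
    filter_upwards [eventually_extChartAt_target x] with z hz
    exact chartField_coordField hz i
  rw [lieBracket, (h i).fderiv_eq, (h j).fderiv_eq]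
  simp
  rfl

end calculus

/-! ### Jacobi's formula, linear systems and the divergence. -/

/-- Jacobi's formula. The determinant is multilinear in the rows, so its derivative replaces one row
at a time, and Cramer's rule identifies each resulting determinant with an entry of the product with
the adjugate. -/
theorem Matrix.hasFDerivAt_det {ι : Type*} [Fintype ι] [DecidableEq ι] (A : ι → ι → ℝ) :
    ∃ L : (ι → ι → ℝ) →L[ℝ] ℝ,
      HasFDerivAt (fun B : ι → ι → ℝ ↦ Matrix.det (Matrix.of B)) L A ∧
      ∀ B : ι → ι → ℝ, L B = (Matrix.adjugate (Matrix.of A) * Matrix.of B).trace := by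
  let f : ContinuousMultilinearMap ℝ (fun _ : ι ↦ ι → ℝ) ℝ :=
    { (Matrix.detRowAlternating (R := ℝ) (n := ι)).toMultilinearMap with
      cont := by
        change Continuous (fun B : ι → ι → ℝ ↦ Matrix.det (Matrix.of B))
        exact Continuous.matrix_det (continuous_id) }
  refine ⟨f.linearDeriv A, f.hasFDerivAt A, fun B ↦ ?_⟩
  rw [ContinuousMultilinearMap.linearDeriv_apply, Matrix.trace_mul_comm, Matrix.trace]
  refine Finset.sum_congr rfl fun i _ ↦ ?_
  have h := congrFun (Matrix.cramer_eq_adjugate_mulVec (Matrix.of A).transpose (B i)) i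
  rw [Matrix.cramer_transpose_apply] at h
  change Matrix.det (Matrix.updateRow (Matrix.of A) i (B i)) = _
  rw [h]
  simp [Matrix.mulVec, dotProduct, Matrix.mul_apply, ← Matrix.adjugate_transpose, mul_comm]

section calculus
variable {n : ℕ} {M : Type*} [TopologicalSpace M] [ChartedSpace (ModelE n) M]
  [IsManifold (𝓡 (2 * n + 1)) ∞ M]

omit [IsManifold (𝓡 (2 * n + 1)) ∞ M] in
theorem DiffFnAt.comp_symm {a : M → ℝ} {x : M} (ha : DiffFnAt (n := n) a x) :
    DifferentiableAt ℝ (a ∘ (extChartAt (𝓡 (2 * n + 1)) x).symm)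
      (extChartAt (𝓡 (2 * n + 1)) x x) := by
  have := ((mdifferentiableAt_iff _ _).1 ha).2
  simpa [differentiableWithinAt_univ] using! this

omit [IsManifold (𝓡 (2 * n + 1)) ∞ M] in
theorem smoothFnAt_det {ι : Type*} [Fintype ι] [DecidableEq ι] {G : M → Matrix ι ι ℝ} {x : M}
    (hG : ∀ i j, SmoothFnAt (n := n) (fun y ↦ G y i j) x) :
    SmoothFnAt (n := n) (fun y ↦ (G y).det) x := by
  simp only [Matrix.det_apply]
  refine contMDiffAt_finsetSum fun σ _ ↦ ?_
  have : SmoothFnAt (n := n) (fun y ↦ ∏ i, G y (σ i) i) x := contMDiffAt_finsetProd fun i _ ↦ hG _ _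
  simp only [Units.smul_def, zsmul_eq_mul]
  exact contMDiffAt_const.mul this

theorem dirDeriv_det {ι : Type*} [Fintype ι] [DecidableEq ι] {G : M → Matrix ι ι ℝ} {x : M}
    (hG : ∀ i j, SmoothFnAt (n := n) (fun y ↦ G y i j) x) (v : TanAt n x) :
    dirDeriv (fun y ↦ (G y).det) x v
      = ((G x).adjugate * Matrix.of fun i j ↦ dirDeriv (fun y ↦ G y i j) x v).trace := by
  rw [dirDeriv_eq_fderiv (smoothFnAt_det hG).diff]
  obtain ⟨L, hL, hL2⟩ := Matrix.hasFDerivAt_det (G x)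
  set φ := extChartAt (𝓡 (2 * n + 1)) x with hφ
  have h1 : HasFDerivAt (fun z i j ↦ G (φ.symm z) i j)
      (ContinuousLinearMap.pi fun i ↦ ContinuousLinearMap.pi fun j ↦
        fderiv ℝ ((fun y ↦ G y i j) ∘ φ.symm) (φ x)) (φ x) :=
    hasFDerivAt_pi.2 fun i ↦ hasFDerivAt_pi.2 fun j ↦ (hG i j).diff.comp_symm.hasFDerivAt
  have hx : φ.symm (φ x) = x := extChartAt_to_inv x
  have h2 := HasFDerivAt.comp (f := fun z i j ↦ G (φ.symm z) i j) (φ x) (by rw [hx]; exact hL) h1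
  have h3 : (fun y ↦ (G y).det) ∘ φ.symm = (fun B : ι → ι → ℝ ↦ Matrix.det (Matrix.of B)) ∘
    (fun z i j ↦ G (φ.symm z) i j) := rfl
  rw [h3, h2.fderiv]
  refine (hL2 _).trans ?_
  congr 2
  ext i j
  exact (dirDeriv_eq_fderiv (hG i j).diff v).symm

omit [IsManifold (𝓡 (2 * n + 1)) ∞ M] in
/-- The solution of a nondegenerate linear system with smooth coefficients is smooth. -/
theorem smoothFnAt_of_linear_system {ι : Type*} [Fintype ι] [DecidableEq ι]
    {G : M → Matrix ι ι ℝ} {c b : M → ι → ℝ} {x : M}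
    (hG : ∀ i j, SmoothFnAt (n := n) (fun y ↦ G y i j) x)
    (hb : ∀ i, SmoothFnAt (n := n) (fun y ↦ b y i) x) (hdet : (G x).det ≠ 0)
    (h : ∀ᶠ y in 𝓝 x, (G y).mulVec (c y) = b y) (i : ι) :
    SmoothFnAt (n := n) (fun y ↦ c y i) x := by
  -- Cramer's rule: the solution is this determinant divided by `det G`, which stays nonzero near
  -- `x`.
  have h1 : SmoothFnAt (n := n) (fun y ↦ ((G y).updateCol i (b y)).det) x := by
    refine smoothFnAt_det fun k l ↦ ?_
    by_cases hl : l = i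
    · subst hl; simpa using hb k
    · simpa [Matrix.updateCol_apply, hl] using hG k l
  have h2 := smoothFnAt_det hG
  refine (h1.mul (h2.inv₀ hdet)).congr_of_eventuallyEq ?_
  filter_upwards [h, h2.continuousAt.eventually_ne hdet] with y hy hd
  have h3 := congrFun (congrArg (G y).cramer hy) i
  rw [Matrix.cramer_eq_adjugate_mulVec, Matrix.mulVec_mulVec, Matrix.adjugate_mul,
    Matrix.cramer_apply] at h3
  simp only [Pi.mul_apply]
  rw [← h3]
  simp [Matrix.smul_mulVec]
  field_simp

theorem coordField_self (x : M) (i : Fin (2 * n + 1)) :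
    coordField x i x = (EuclideanSpace.single i 1 : ModelE n) := by
  rw [coordField, TangentBundle.symmL_trivializationAt (mem_chart_source _ _),
    mfderivWithin_range_extChartAt_symm]
  rfl

theorem eventually_coordVec_eq (x : M) (i : Fin (2 * n + 1)) {z : ModelE n}
    (hz : z ∈ (extChartAt (𝓡 (2 * n + 1)) x).target) :
    mfderiv 𝓘(ℝ, ModelE n) (𝓡 (2 * n + 1)) (extChartAt (𝓡 (2 * n + 1)) x).symm z
      (EuclideanSpace.single i (1 : ℝ))
        = coordField x i ((extChartAt (𝓡 (2 * n + 1)) x).symm z) := by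
  rw [← mfderiv_symm_chartField (coordField x i) hz, chartField_coordField hz]

theorem mfderiv_extChartAt_apply (x : M) (i : Fin (2 * n + 1)) {y : M}
    (hy : y ∈ (chartAt (ModelE n) x).source) (v : TanAt n y) :
    (show ModelE n from
      mfderiv (𝓡 (2 * n + 1)) 𝓘(ℝ, ModelE n) (extChartAt (𝓡 (2 * n + 1)) x) y v) i
      = coordCoef x i y v := by
  rw [coordCoef, TangentBundle.continuousLinearMapAt_trivializationAt hy]
  rfl

/-- The Gram matrix of a metric in the preferred chart at `x`. -/
def gram (g : ∀ x : M, LinearMap.BilinForm ℝ (TanAt n x)) (x y : M) :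
    Matrix (Fin (2 * n + 1)) (Fin (2 * n + 1)) ℝ :=
  Matrix.of fun i j ↦ g y (coordField x i y) (coordField x j y)

/-- Near `x` the coordinate vectors and components in the definition of the divergence are those of
the bundle trivialization, so its Euclidean derivatives become derivatives of functions on `M`. -/
theorem divergence_eq_sum {g : ∀ x : M, LinearMap.BilinForm ℝ (TanAt n x)}
    {X : ∀ x : M, TanAt n x} {x : M}
    (h : ∀ i, DiffFnAt (n := n) (fun y ↦ √(gram g x y).det * coordCoef x i y (X y)) x) :
    divergence g X x = (1 / √(gram g x x).det) *
      ∑ i, dirDeriv (fun y ↦ √(gram g x y).det * coordCoef x i y (X y)) x (coordField x i x) := by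
  have hd : ∀ {z : ModelE n}, z ∈ (extChartAt (𝓡 (2 * n + 1)) x).target →
      √(Matrix.det (Matrix.of fun i j ↦ g ((extChartAt (𝓡 (2 * n + 1)) x).symm z)
      (mfderiv 𝓘(ℝ, ModelE n) (𝓡 (2 * n + 1)) (extChartAt (𝓡 (2 * n + 1)) x).symm z
        (EuclideanSpace.single i (1 : ℝ)))
      (mfderiv 𝓘(ℝ, ModelE n) (𝓡 (2 * n + 1)) (extChartAt (𝓡 (2 * n + 1)) x).symm z
        (EuclideanSpace.single j (1 : ℝ))))) =
        √(gram g x ((extChartAt (𝓡 (2 * n + 1)) x).symm z)).det := by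
    intro z hz
    simp only [eventually_coordVec_eq x _ hz, gram]
  simp only [divergence]
  rw [hd (mem_extChartAt_target x), extChartAt_to_inv]
  congr 1
  refine Finset.sum_congr rfl fun i _ ↦ ?_
  rw [dirDeriv_eq_fderiv (h i), coordField_self]
  congr 1
  refine Filter.EventuallyEq.fderiv_eq ?_
  filter_upwards [eventually_extChartAt_target x] with z hz
  have hy : (extChartAt (𝓡 (2 * n + 1)) x).symm z ∈ (chartAt (ModelE n) x).source := by
    simpa using (extChartAt (𝓡 (2 * n + 1)) x).map_target hz
  rw [hd hz]
  exact congrArg _ (mfderiv_extChartAt_apply x i hy _)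

omit [IsManifold (𝓡 (2 * n + 1)) ∞ M] in
theorem dirDeriv_mul {f g : M → ℝ} {x : M} (hf : DiffFnAt (n := n) f x)
    (hg : DiffFnAt (n := n) g x) (v : TanAt n x) :
    dirDeriv (fun y ↦ f y * g y) x v = f x * dirDeriv g x v + g x * dirDeriv f x v := by
  rw [dirDeriv, mvfderiv_fun_mul hf hg]
  simp

omit [IsManifold (𝓡 (2 * n + 1)) ∞ M] in
theorem dirDeriv_add {f g : M → ℝ} {x : M} (hf : DiffFnAt (n := n) f x)
    (hg : DiffFnAt (n := n) g x) (v : TanAt n x) :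
    dirDeriv (fun y ↦ f y + g y) x v = dirDeriv f x v + dirDeriv g x v := by
  rw [dirDeriv, mvfderiv_fun_add hf hg]
  simp

omit [IsManifold (𝓡 (2 * n + 1)) ∞ M] in
theorem dirDeriv_const (c : ℝ) (x : M) (v : TanAt n x) :
    dirDeriv (fun _ : M ↦ c) x v = 0 := by
  rw [dirDeriv, mvfderiv_const]
  rfl

omit [IsManifold (𝓡 (2 * n + 1)) ∞ M] in
theorem dirDeriv_sum {ι : Type*} {s : Finset ι} {f : ι → M → ℝ} {x : M}
    (hf : ∀ i ∈ s, DiffFnAt (n := n) (f i) x) (v : TanAt n x) :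
    dirDeriv (fun y ↦ ∑ i ∈ s, f i y) x v = ∑ i ∈ s, dirDeriv (f i) x v := by
  classical
  have : DiffFnAt (n := n) (fun y ↦ ∑ i ∈ s, f i y) x ∧
      dirDeriv (fun y ↦ ∑ i ∈ s, f i y) x v = ∑ i ∈ s, dirDeriv (f i) x v := by
    induction s using Finset.induction_on with
    | empty => simpa using ⟨mdifferentiableAt_const, dirDeriv_const 0 x v⟩
    | insert a s ha h =>
      simp only [Finset.mem_insert, forall_eq_or_imp] at hf
      simp only [Finset.sum_insert ha]
      obtain ⟨h1, h2⟩ := h hf.2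
      exact ⟨hf.1.add h1, by rw [dirDeriv_add hf.1 h1, h2]⟩
  exact this.2

/-- The derivative of the square root of the determinant of a matrix `G` with
`dG(v) = Cᵀ G + G C`. -/
theorem dirDeriv_sqrt_det {ι : Type*} [Fintype ι] [DecidableEq ι] {G : M → Matrix ι ι ℝ} {x : M}
    (hG : ∀ i j, SmoothFnAt (n := n) (fun y ↦ G y i j) x) (hdet : 0 < (G x).det) (v : TanAt n x)
    (C : Matrix ι ι ℝ)
    (hC : (Matrix.of fun i j ↦ dirDeriv (fun y ↦ G y i j) x v) = C.transpose * G x + G x * C) :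
    SmoothFnAt (n := n) (fun y ↦ √(G y).det) x ∧
    dirDeriv (fun y ↦ √(G y).det) x v = √(G x).det * C.trace := by
  have h1 := smoothFnAt_det hG
  have h2 : ContDiffAt ℝ ∞ Real.sqrt (G x).det := Real.contDiffAt_sqrt hdet.ne'
  have h3 : SmoothFnAt (n := n) (fun y ↦ √(G y).det) x :=
    h2.contMDiffAt.comp (I' := 𝓘(ℝ, ℝ)) x h1
  refine ⟨h3, ?_⟩
  have h4 : dirDeriv (fun y ↦ (G y).det) x v = 2 * (G x).det * C.trace := by
    rw [dirDeriv_det hG, hC, mul_add, Matrix.trace_add, ← Matrix.mul_assoc (G x).adjugate (G x) C,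
      Matrix.adjugate_mul, Matrix.trace_mul_comm, Matrix.mul_assoc, Matrix.mul_adjugate]
    simp
    ring
  -- The root is differentiated through its square, which is `det G` wherever `det G` is positive.
  have h5 : dirDeriv (fun y ↦ √(G y).det * √(G y).det) x v = 2 * (G x).det * C.trace := by
    rw [← h4, dirDeriv_congr]
    filter_upwards [h1.continuousAt.eventually (lt_mem_nhds hdet)] with y hy
    exact Real.mul_self_sqrt hy.le
  rw [dirDeriv_mul h3.diff h3.diff] at h5
  have h6 := Real.sqrt_pos.2 hdet
  have h7 := Real.mul_self_sqrt hdet.le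
  have : √(G x).det * (dirDeriv (fun y ↦ √(G y).det) x v - √(G x).det * C.trace) = 0 := by
    linear_combination h5 / 2 - C.trace * h7
  rcases mul_eq_zero.1 this with h | h
  · exact absurd h h6.ne'
  · linarith

theorem trace_eq_sum_coordCoef {x y : M} (hy : y ∈ (chartAt (ModelE n) x).source)
    (L : TanAt n y →ₗ[ℝ] TanAt n y) :
    LinearMap.trace ℝ _ L = ∑ i, coordCoef x i y (L (coordField x i y)) := by
  have h : L = ∑ i, (coordCoef x i y).smulRight (L (coordField x i y)) := by
    ext v
    conv_lhs => rw [← sum_coordCoef_smul hy v]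
    simp
  conv_lhs => rw [h]
  simp [LinearMap.trace_smulRight]

omit [IsManifold (𝓡 (2 * n + 1)) ∞ M] in
theorem bracket_congr {U V W : ∀ y : M, TanAt n y} {x : M} (h : ∀ᶠ y in 𝓝 x, U y = V y) :
    bracket U W x = bracket V W x :=
  Filter.EventuallyEq.mlieBracket_vectorField_eq h (Filter.EventuallyEq.refl _ _)

theorem bracket_sum_left {ι : Type*} {s : Finset ι} {X : ι → ∀ y : M, TanAt n y} {x : M}
    (hX : ∀ i ∈ s, DiffFieldAt (X i) x) (Y : ∀ y : M, TanAt n y) :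
    bracket (fun y ↦ ∑ i ∈ s, X i y) Y x = ∑ i ∈ s, bracket (X i) Y x := by
  classical
  induction s using Finset.induction_on with
  | empty =>
    simp only [Finset.sum_empty]
    exact congrFun (mlieBracket_zero_left (I := 𝓡 (2 * n + 1)) (W := Y)) x
  | insert a s ha h =>
    simp only [Finset.mem_insert, forall_eq_or_imp] at hX
    simp only [Finset.sum_insert ha, ← h hX.2]
    exact mlieBracket_add_left hX.1 (MDifferentiableAt.sum_section hX.2)

/-- After expanding `X` in coordinate fields, whose brackets vanish at `x`, only the derivatives of
the coefficients survive. -/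
theorem coordCoef_bracket_coordField {X : ∀ y : M, TanAt n y} {x : M} (hX : SmoothFieldAt X x)
    (i : Fin (2 * n + 1)) :
    coordCoef x i x (bracket X (coordField x i) x)
      = - dirDeriv (fun y ↦ coordCoef x i y (X y)) x (coordField x i x) := by
  have hx := mem_chart_source (ModelE n) x
  have hE := fun j ↦ smoothFieldAt_coordField hx (n := n) j
  have hc := fun j ↦ smoothFnAt_coordCoef hX j
  rw [bracket_congr (eventually_sum_coordCoef_smul x X),
    bracket_sum_left (X := fun j y ↦ coordCoef x j y (X y) • coordField x j y)
      (fun j _ ↦ ((hc j).smul_section (hE j)).mdifferentiableAt (by simp))]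
  have h : ∀ j, bracket (fun y ↦ coordCoef x j y (X y) • coordField x j y) (coordField x i) x
      = - dirDeriv (fun y ↦ coordCoef x j y (X y)) x (coordField x i x) • coordField x j x := by
    intro j
    have := mlieBracket_smul_left (W := coordField x i) (hc j).diff (hE j).diff
    refine Eq.trans this ?_
    have h0 := bracket_coordField x j i
    simp only [bracket] at h0
    rw [h0]
    simp
  simp [h, coordCoef_coordField hx]

/-- The divergence of a vector field, through a metric connection with torsion. -/
theorem divergence_eq_trace {g : ∀ x : M, LinearMap.BilinForm ℝ (TanAt n x)}
    (cov : LinearConnection n M) {x : M} (hsymm : ∀ u v, g x u v = g x v u)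
    (hpos : ∀ v, v ≠ 0 → 0 < g x v v)
    (hG : ∀ i j, SmoothFnAt (n := n) (fun y ↦ gram g x y i j) x)
    (hcomp : ∀ Y Z : ∀ y : M, TanAt n y, DiffFieldAt Y x → DiffFieldAt Z x → ∀ v : TanAt n x,
      dirDeriv (fun y ↦ g y (Y y) (Z y)) x v = g x (cov Y x v) (Z x) + g x (Y x) (cov Z x v))
    {X : ∀ x : M, TanAt n x} (hX : SmoothFieldAt X x) :
    divergence g X x = LinearMap.trace ℝ (TanAt n x)
      ((cov X x).toLinearMap + (cov.torsion x (X x)).toLinearMap) := by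
  have hx := mem_chart_source (ModelE n) x
  have hE := fun j ↦ smoothFieldAt_coordField hx (n := n) j
  have hc := fun j ↦ smoothFnAt_coordCoef hX j
  have hdet : 0 < (gram g x x).det := by
    refine Matrix.PosDef.det_pos (Matrix.PosDef.of_dotProduct_mulVec_pos ?_ ?_)
    · ext i j
      simp [gram, hsymm]
    · intro c hc0
      have h1 : (∑ i, c i • coordField x i x) ≠ 0 := by
        intro h0
        refine hc0 (funext fun i ↦ ?_)
        have := congrArg (coordCoef x i x) h0
        simpa [coordCoef_coordField hx] using this
      have h2 := hpos _ h1
      refine lt_of_lt_of_eq h2 ?_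
      simp only [map_sum, map_smul, LinearMap.sum_apply, LinearMap.smul_apply, smul_eq_mul, gram,
        Matrix.mulVec, dotProduct, Finset.mul_sum, Matrix.of_apply, Pi.star_apply, star_trivial]
      refine Finset.sum_congr rfl fun i _ ↦ Finset.sum_congr rfl fun j _ ↦ ?_
      rw [hsymm]
      ring
  -- `C` is the matrix of `∇_X` on the coordinate frame. Metric compatibility is then `X(G) = Cᵀ G +
  -- G C`, so the logarithmic derivative of the volume density along `X` is `tr C`.
  let C : Matrix (Fin (2 * n + 1)) (Fin (2 * n + 1)) ℝ :=
    Matrix.of fun k i ↦ coordCoef x k x (cov (coordField x i) x (X x))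
  have hcE : ∀ i, cov (coordField x i) x (X x) = ∑ k, C k i • coordField x k x := fun i ↦
    (sum_coordCoef_smul hx _).symm
  have hC : (Matrix.of fun i j ↦ dirDeriv (fun y ↦ gram g x y i j) x (X x))
      = C.transpose * gram g x x + gram g x x * C := by
    ext i j
    have := hcomp _ _ (hE i).diff (hE j).diff (X x)
    rw [hcE, hcE] at this
    simp only [map_sum, map_smul, LinearMap.sum_apply, LinearMap.smul_apply, smul_eq_mul] at this
    refine this.trans ?_
    simp only [Matrix.add_apply, Matrix.mul_apply, Matrix.transpose_apply]
    congr 1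
    exact Finset.sum_congr rfl fun k _ ↦ mul_comm _ _
  obtain ⟨hs, hds⟩ := dirDeriv_sqrt_det hG hdet (X x) C hC
  have hs0 := Real.sqrt_pos.2 hdet
  have hsc : ∀ i, SmoothFnAt (n := n) (fun y ↦ √(gram g x y).det * coordCoef x i y (X y)) x :=
    fun i ↦ hs.mul (hc i)
  rw [divergence_eq_sum (fun i ↦ (hsc i).diff), trace_eq_sum_coordCoef hx]
  have h1 : ∑ i, coordCoef x i x (X x) * dirDeriv (fun y ↦ √(gram g x y).det) x (coordField x i x)
      = √(gram g x x).det * C.trace := by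
    rw [← hds]
    conv_rhs => rw [← sum_coordCoef_smul hx (X x)]
    simp
  -- Here `∇_{E_i} X + T_∇(X, E_i) = ∇_X E_i - [X, E_i]`. The first term contributes `C i i`, the
  -- bracket the derivative of the component `X^i`.
  have h2 : ∀ i, coordCoef x i x (((cov X x).toLinearMap + (cov.torsion x (X x)).toLinearMap)
      (coordField x i x))
        = C i i + dirDeriv (fun y ↦ coordCoef x i y (X y)) x (coordField x i x) := by
    intro i
    have := coordCoef_bracket_coordField hX i
    simp only [LinearMap.add_apply, ContinuousLinearMap.coe_coe]
    rw [cov.torsion_apply hX.diff (hE i).diff, map_add, map_sub, map_sub]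
    simp only [bracket] at this
    rw [this]
    simp only [C, Matrix.of_apply]
    ring
  simp only [h2, dirDeriv_mul hs.diff (hc _).diff, Finset.sum_add_distrib, h1, ← Finset.mul_sum]
  rw [Matrix.trace]
  simp only [Matrix.diag_apply]
  field_simp
  ring

/-- A vector field of class `C^∞` on `M`. -/
abbrev SmoothField (X : ∀ y : M, TanAt n y) : Prop := ∀ x, SmoothFieldAt X x

theorem extendVec_eq_sum {x y : M} (hy : y ∈ (chartAt (ModelE n) x).source) (v : TanAt n x) :
    extendVec v y = ∑ i, coordCoef x i x v • coordField x i y := by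
  have h : y ∈ (trivializationAt (ModelE n) (TangentSpace (𝓡 (2 * n + 1))) x).baseSet := by
    simpa using hy
  have hx : x ∈ (trivializationAt (ModelE n) (TangentSpace (𝓡 (2 * n + 1))) x).baseSet := by
    simp
  simp only [coordField, ← map_smul, ← map_sum, FiberBundle.extend]
  rw [← Trivialization.symmL_apply (R := ℝ) _ h]
  congr 1
  ext j
  rw [Trivialization.apply_eq_prod_continuousLinearEquivAt ℝ _ _ hx]
  simp [coordCoef, Pi.single_apply, Trivialization.linearMapAt_apply]

/-! ### Globally smooth extensions of tangent vectors. -/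

section bump

variable [T2Space M]

/-- A smooth bump function at `x`. -/
def cutoff (n : ℕ) {M : Type*} [TopologicalSpace M] [ChartedSpace (ModelE n) M] (x : M) :
    SmoothBumpFunction (𝓡 (2 * n + 1)) x :=
  Nonempty.some inferInstance

/-- A smooth vector field on `M` which is the `i`-th coordinate field of the preferred chart at `x`
near `x`. -/
def globField (x : M) (i : Fin (2 * n + 1)) : ∀ y : M, TanAt n y :=
  (cutoff n x : M → ℝ) • coordField x i

omit [T2Space M] in
theorem globField_eventually (x : M) (i : Fin (2 * n + 1)) :
    ∀ᶠ y in 𝓝 x, globField x i y = coordField x i y := by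
  filter_upwards [(cutoff n x).eventuallyEq_one] with y hy
  simp [globField, hy]

omit [T2Space M] in
theorem globField_self (x : M) (i : Fin (2 * n + 1)) : globField x i x = coordField x i x :=
  (globField_eventually x i).self_of_nhds

/-- The closed support of the cutoff lies in the chart domain because `M` is Hausdorff. Global
smoothness matters because smoothness of `∇` is applied below to fields smooth on all of `M`. -/
theorem smoothField_globField (x : M) (i : Fin (2 * n + 1)) : SmoothField (globField x i) := by
  have h := ContMDiffOn.smul_section_of_tsupport (I := 𝓡 (2 * n + 1)) (F := ModelE n)
    (V := TangentSpace (𝓡 (2 * n + 1))) (n := ∞) (s := coordField x i)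
    (ψ := (cutoff n x : M → ℝ)) (u := (chartAt (ModelE n) x).source)
    (SmoothBumpFunction.contMDiff _).contMDiffOn
    (chartAt (ModelE n) x).open_source (SmoothBumpFunction.tsupport_subset_chartAt_source _)
    (fun y hy ↦ (smoothFieldAt_coordField hy i).contMDiffWithinAt)
  exact h

/-- A smooth vector field on `M` extending `v`. -/
def globVec {x : M} (v : TanAt n x) : ∀ y : M, TanAt n y :=
  fun y ↦ ∑ i, coordCoef x i x v • globField x i y

theorem smoothField_globVec {x : M} (v : TanAt n x) : SmoothField (globVec v) := fun y ↦
  SmoothFieldAt.sum (X := fun i y ↦ coordCoef x i x v • globField x i y) fun i _ ↦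
    (contMDiffAt_const (c := coordCoef x i x v)).smul_section (smoothField_globField x i y)

omit [T2Space M] in
theorem globVec_eventually {x : M} (v : TanAt n x) : ∀ᶠ y in 𝓝 x, globVec v y = extendVec v y := by
  filter_upwards [eventually_chart_source (n := n) x,
    Filter.eventually_all.2 (globField_eventually (n := n) x)] with y hy h
  simp [globVec, h, extendVec_eq_sum hy]

omit [T2Space M] in
theorem globVec_self {x : M} (v : TanAt n x) : globVec v x = v := by
  rw [(globVec_eventually v).self_of_nhds]
  simp

end bump

/-! ### Rules for covariant derivatives of fields. -/

theorem cov_congr (cov : LinearConnection n M) {X Y : ∀ y : M, TanAt n y} {x : M}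
    (hX : DiffFieldAt X x) (h : ∀ᶠ y in 𝓝 x, Y y = X y) : cov Y x = cov X x := by
  have hY : DiffFieldAt Y x :=
    hX.congr_of_eventuallyEq (by filter_upwards [h] with y hy; rw [hy])
  exact (cov.isCovariantDerivativeOn (s := Set.univ)).congr_of_eventuallyEq hY hX Filter.univ_mem h

theorem cov_add (cov : LinearConnection n M) {X Y : ∀ y : M, TanAt n y} {x : M}
    (hX : DiffFieldAt X x) (hY : DiffFieldAt Y x) :
    cov (fun y ↦ X y + Y y) x = cov X x + cov Y x :=
  (cov.isCovariantDerivativeOn (s := Set.univ)).add hX hY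

theorem cov_smul (cov : LinearConnection n M) {a : M → ℝ} {X : ∀ y : M, TanAt n y} {x : M}
    (ha : DiffFnAt (n := n) a x) (hX : DiffFieldAt X x) (v : TanAt n x) :
    cov (fun y ↦ a y • X y) x v = a x • cov X x v + dirDeriv a x v • X x := by
  have := (cov.isCovariantDerivativeOn (s := Set.univ)).leibniz hX ha
  exact congrArg (fun L ↦ L v) this

theorem cov_sum (cov : LinearConnection n M) {ι : Type*} {s : Finset ι}
    {X : ι → ∀ y : M, TanAt n y} {x : M} (hX : ∀ i ∈ s, DiffFieldAt (X i) x) :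
    cov (fun y ↦ ∑ i ∈ s, X i y) x = ∑ i ∈ s, cov (X i) x := by
  classical
  induction s using Finset.induction_on with
  | empty =>
    simp only [Finset.sum_empty]
    exact congrFun cov.zero x
  | insert a s ha h =>
    simp only [Finset.mem_insert, forall_eq_or_imp] at hX
    simp only [Finset.sum_insert ha, ← h hX.2]
    exact cov_add cov hX.1 (MDifferentiableAt.sum_section hX.2)

/-- The covariant derivative of `W` along a vector field `V`. -/
def covField (cov : LinearConnection n M) (V W : ∀ y : M, TanAt n y) : ∀ y : M, TanAt n y :=
  fun y ↦ cov W y (V y)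

theorem diffFieldAt_covField {cov : LinearConnection n M}
    (hcov : CovariantDerivative.ContMDiffCovariantDerivative cov ∞) {V W : ∀ y : M, TanAt n y}
    (hW : SmoothField W) {x : M} (hV : DiffFieldAt V x) : DiffFieldAt (covField cov V W) x := by
  have h1 := hcov.contMDiff.contMDiff (σ := W) (fun y _ ↦ (hW y).contMDiffWithinAt)
  rw [contMDiffOn_univ] at h1
  exact ((h1 x).mdifferentiableAt (by simp)).clm_bundle_apply hV

theorem smoothField_covField {cov : LinearConnection n M}
    (hcov : CovariantDerivative.ContMDiffCovariantDerivative cov ∞) {V W : ∀ y : M, TanAt n y}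
    (hV : SmoothField V) (hW : SmoothField W) : SmoothField (covField cov V W) := by
  have h1 := hcov.contMDiff.contMDiff (σ := W) (fun y _ ↦ (hW y).contMDiffWithinAt)
  rw [contMDiffOn_univ] at h1
  exact fun x ↦ (h1 x).clm_bundle_apply (hV x)

end calculus

/-! ### Tensoriality of the curvature. -/

section curvature
variable {n : ℕ} {M : Type*} [TopologicalSpace M] [ChartedSpace (ModelE n) M]
  [IsManifold (𝓡 (2 * n + 1)) ∞ M]

/-- The curvature `R(U, V) W` of vector fields. -/
def curvField (cov : LinearConnection n M) (U V W : ∀ y : M, TanAt n y) (x : M) : TanAt n x :=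
  cov (covField cov V W) x (U x) - cov (covField cov U W) x (V x) - cov W x (bracket U V x)

theorem curvField_swap (cov : LinearConnection n M) (U V W : ∀ y : M, TanAt n y) (x : M) :
    curvField cov U V W x = - curvField cov V U W x := by
  simp only [curvField, bracket]
  rw [mlieBracket_swap_apply, map_neg]
  abel

variable {cov : LinearConnection n M}
  (hcov : CovariantDerivative.ContMDiffCovariantDerivative cov ∞)

include hcov

/-- For a factor `f` on `V`, the Leibniz term `U(f) ∇_V W` cancels against the one coming from `[U,
fV]`. -/
theorem curvField_tensorial_right (U : ∀ y : M, TanAt n y) {W : ∀ y : M, TanAt n y} {x : M}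
    (hW : SmoothField W) :
    TensorialAt (𝓡 (2 * n + 1)) (ModelE n) (fun V ↦ curvField cov U V W x) x where
  smul {f V} hf hV := by
    have e1 : covField cov (f • V) W = fun y ↦ f y • covField cov V W y := by
      ext1 y; simp [covField]
    have e2 : bracket U (f • V) x = _ := mlieBracket_smul_right (V := U) hf hV
    simp only [curvField, e1, e2, cov_smul cov hf (diffFieldAt_covField hcov hW hV)]
    simp [covField]
    module
  add {V V'} hV hV' := by
    have e1 : covField cov (V + V') W = fun y ↦ covField cov V W y + covField cov V' W y := by
      ext1 y; simp [covField]
    have e2 : bracket U (V + V') x = _ := mlieBracket_add_right (V := U) hV hV'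
    simp only [curvField, e1, e2, cov_add cov (diffFieldAt_covField hcov hW hV)
      (diffFieldAt_covField hcov hW hV')]
    simp
    abel

theorem curvField_tensorial_left (V : ∀ y : M, TanAt n y) {W : ∀ y : M, TanAt n y} {x : M}
    (hW : SmoothField W) :
    TensorialAt (𝓡 (2 * n + 1)) (ModelE n) (fun U ↦ curvField cov U V W x) x where
  smul {f U} hf hU := by
    rw [curvField_swap, (curvField_tensorial_right hcov V hW).smul hf hU, curvField_swap cov U]
    simp
  add {U U'} hU hU' := by
    rw [curvField_swap, (curvField_tensorial_right hcov V hW).add hU hU', curvField_swap cov U,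
      curvField_swap cov U']
    abel

omit hcov in
theorem covField_smul_eventually {a : M → ℝ} {V W : ∀ y : M, TanAt n y} {x : M}
    (ha : SmoothFnAt (n := n) a x) (hW : SmoothField W) :
    ∀ᶠ y in 𝓝 x, covField cov V (fun z ↦ a z • W z) y
      = a y • covField cov V W y + dirDeriv a y (V y) • W y := by
  filter_upwards [ha.eventually_diff] with y hy
  exact cov_smul cov hy (hW y).diff (V y)

theorem smoothFieldAt_covField_smul {a : M → ℝ} {V W : ∀ y : M, TanAt n y} {x : M}
    (ha : SmoothFnAt (n := n) a x) (hV : SmoothField V) (hW : SmoothField W) :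
    SmoothFieldAt (covField cov V (fun z ↦ a z • W z)) x :=
  SmoothFieldAt.congr (((smoothField_covField hcov hV hW x).smul ha).add
    ((hW x).smul (ha.dirDeriv (hV x)))) (covField_smul_eventually ha hW)

theorem cov_covField_smul {a : M → ℝ} {V W : ∀ y : M, TanAt n y} {x : M}
    (ha : SmoothFnAt (n := n) a x) (hV : SmoothField V) (hW : SmoothField W) (u : TanAt n x) :
    cov (covField cov V (fun z ↦ a z • W z)) x u
      = a x • cov (covField cov V W) x u + dirDeriv a x u • covField cov V W x
        + dirDeriv a x (V x) • cov W x u + dirDeriv (fun y ↦ dirDeriv a y (V y)) x u • W x := by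
  have h1 := smoothField_covField hcov hV hW x
  rw [cov_congr cov (SmoothFieldAt.add (h1.smul ha) ((hW x).smul (ha.dirDeriv (hV x)))).diff
    (covField_smul_eventually ha hW)]
  have h2 : cov (a • covField cov V W + (fun y ↦ dirDeriv a y (V y)) • W) x
      = cov (a • covField cov V W) x + cov ((fun y ↦ dirDeriv a y (V y)) • W) x :=
    cov_add cov (h1.smul ha).diff ((hW x).smul (ha.dirDeriv (hV x))).diff
  have h3 := cov_smul cov ha.diff h1.diff u
  have h4 := cov_smul cov (ha.dirDeriv (hV x)).diff (hW x).diff u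
  rw [h2, _root_.add_apply]
  refine (congrArg₂ (· + ·) h3 h4).trans ?_
  module

/-- The mixed first-order terms are symmetric in `U` and `V`, and the second derivatives of `a`
combine to `[U, V] a`, which the bracket term removes. -/
theorem curvField_smul {a : M → ℝ} {U V W : ∀ y : M, TanAt n y} {x : M}
    (ha : SmoothFnAt (n := n) a x) (hU : SmoothField U) (hV : SmoothField V)
    (hW : SmoothField W) :
    curvField cov U V (fun z ↦ a z • W z) x = a x • curvField cov U V W x := by
  simp only [curvField, cov_covField_smul hcov ha hV hW, cov_covField_smul hcov ha hU hW,
    cov_smul cov ha.diff (hW x).diff, dirDeriv_bracket ha (hU x) (hV x), covField]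
  module

/-- This gives dependence on `W x` alone. `W` is differentiated twice, so `TensorialAt`, which tests
fields merely differentiable at `x`, does not fit this slot; an explicit expansion in a smooth frame
replaces it. -/
theorem curvField_eq_sum [T2Space M] {U V W : ∀ y : M, TanAt n y} {x : M}
    (hU : SmoothField U) (hV : SmoothField V) (hW : SmoothField W) :
    curvField cov U V W x = ∑ i, coordCoef x i x (W x) • curvField cov U V (globField x i) x := by
  have hc := fun i ↦ smoothFnAt_coordCoef (hW x) i
  have hg := fun i ↦ smoothField_globField (n := n) x i
  have hsm := fun i ↦ SmoothFieldAt.smul (hc i) (hg i x)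
  have h1 : ∀ᶠ y in 𝓝 x, W y = ∑ i, coordCoef x i y (W y) • globField x i y := by
    filter_upwards [eventually_sum_coordCoef_smul x W,
      Filter.eventually_all.2 (globField_eventually (n := n) x)] with y hy h
    simp only [h]
    exact hy
  have h3 : ∀ V' : ∀ y : M, TanAt n y, ∀ᶠ y in 𝓝 x, covField cov V' W y
      = ∑ i, covField cov V' (fun z ↦ coordCoef x i z (W z) • globField x i z) y := by
    intro V'
    filter_upwards [h1.eventually_nhds, Filter.eventually_all.2 fun i ↦ (hsm i).eventually_diff]
      with y hy hd
    have := cov_congr cov (X := fun z ↦ ∑ i, coordCoef x i z (W z) • globField x i z)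
      (MDifferentiableAt.sum_section fun i _ ↦ hd i) hy
    rw [covField, this, cov_sum cov (X := fun i z ↦ coordCoef x i z (W z) • globField x i z)
      (fun i _ ↦ hd i)]
    simp [covField]
  have h4 : ∀ V' : ∀ y : M, TanAt n y, SmoothField V' → cov (covField cov V' W) x
      = ∑ i, cov (covField cov V' (fun z ↦ coordCoef x i z (W z) • globField x i z)) x := by
    intro V' hV'
    have hd := fun i ↦ (smoothFieldAt_covField_smul hcov (hc i) hV' (hg i)).diff
    rw [cov_congr cov (MDifferentiableAt.sum_section fun i _ ↦ hd i) (h3 V'),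
      cov_sum cov fun i _ ↦ hd i]
  have h5 : cov W x = ∑ i, cov (fun z ↦ coordCoef x i z (W z) • globField x i z) x := by
    rw [cov_congr cov (X := fun z ↦ ∑ i, coordCoef x i z (W z) • globField x i z)
      (MDifferentiableAt.sum_section fun i _ ↦ (hsm i).diff) h1, cov_sum cov
      (X := fun i z ↦ coordCoef x i z (W z) • globField x i z) fun i _ ↦ (hsm i).diff]
  have h6 : curvField cov U V W x
      = ∑ i, curvField cov U V (fun z ↦ coordCoef x i z (W z) • globField x i z) x := by
    simp only [curvField, h4 V hV, h4 U hU, h5, _root_.sum_apply,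
      Finset.sum_sub_distrib]
  rw [h6]
  exact Finset.sum_congr rfl fun i _ ↦ curvField_smul hcov (hc i) hU hV (hg i)

/-- The curvature of vector fields at a point depends on their values only. -/
theorem curvature_eq [T2Space M] {U V W : ∀ y : M, TanAt n y} (hU : SmoothField U)
    (hV : SmoothField V) (hW : SmoothField W) (x : M) :
    cov.curvature x (U x) (V x) (W x) = curvField cov U V W x := by
  have hgU := smoothField_globVec (U x)
  have hgV := smoothField_globVec (V x)
  have hgW := smoothField_globVec (W x)
  -- The extensions in the definition of `curvature` agree near `x` with globally smooth ones. The
  -- latter are then exchanged for `U`, `V`, `W` one slot at a time.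
  have h1 : ∀ v v' : TanAt n x, cov (fun y ↦ cov (extendVec (W x)) y (extendVec v y)) x v'
      = cov (covField cov (globVec v) (globVec (W x))) x v' := by
    intro v v'
    rw [cov_congr cov (smoothField_covField hcov (smoothField_globVec v) hgW x).diff]
    filter_upwards [(globVec_eventually (W x)).eventually_nhds, globVec_eventually v] with y hy hv
    have := cov_congr cov (hgW y).diff (hy.mono fun z hz ↦ hz.symm)
    rw [covField, this, hv]
  have h2 : cov (extendVec (W x)) x = cov (globVec (W x)) x :=
    cov_congr cov (hgW x).diff ((globVec_eventually _).mono fun z hz ↦ hz.symm)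
  have h3 : bracket (extendVec (U x)) (extendVec (V x)) x
      = bracket (globVec (U x)) (globVec (V x)) x :=
    (Filter.EventuallyEq.mlieBracket_vectorField_eq (globVec_eventually (U x))
      (globVec_eventually (V x))).symm
  have h4 : cov.curvature x (U x) (V x) (W x)
      = curvField cov (globVec (U x)) (globVec (V x)) (globVec (W x)) x := by
    simp only [LinearConnection.curvature, curvField, h1, h2, h3, globVec_self]
  have h5 := (curvField_tensorial_left hcov (globVec (V x)) hgW).pointwise (hgU x).diff (hU x).diff
    (globVec_self _)
  have h6 := (curvField_tensorial_right hcov U hgW).pointwise (hgV x).diff (hV x).diff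
    (globVec_self _)
  rw [h4]
  refine h5.trans (h6.trans ?_)
  rw [curvField_eq_sum hcov hU hV hgW, curvField_eq_sum hcov hU hV hW, globVec_self]

end curvature

/-! ### Traces of second covariant derivatives and the Ricci tensor. -/

section bochner
variable {n : ℕ} {M : Type*} [TopologicalSpace M] [ChartedSpace (ModelE n) M]
  [IsManifold (𝓡 (2 * n + 1)) ∞ M] [T2Space M] {cov : LinearConnection n M}
  (hcov : CovariantDerivative.ContMDiffCovariantDerivative cov ∞)

include hcov

/-- A trace does not depend on the basis, so the arbitrary basis in the definition of `ricci` may be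
exchanged for the coordinate frame, whose members extend to smooth fields. -/
theorem ricci_eq_sum {Y Z : ∀ y : M, TanAt n y} (hY : SmoothField Y) (hZ : SmoothField Z) (x : M) :
    cov.ricci x (Y x) (Z x)
      = ∑ i, coordCoef x i x (curvField cov (globField x i) Z Y x) := by
  have ht := curvField_tensorial_left hcov Z hY (x := x)
  have hx := mem_chart_source (ModelE n) x
  let L : TanAt n x →L[ℝ] TanAt n x :=
    TensorialAt.mkHom (I := 𝓡 (2 * n + 1)) (F := ModelE n) (fun U ↦ curvField cov U Z Y x) x ht
  have hL : ∀ U, SmoothField U → L (U x) = curvField cov U Z Y x := fun U hU ↦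
    TensorialAt.mkHom_apply ht (hU x).diff
  have h1 : cov.ricci x (Y x) (Z x) = LinearMap.trace ℝ _ L.toLinearMap := by
    rw [LinearMap.trace_eq_matrix_trace ℝ (Module.finBasis ℝ (TanAt n x))]
    simp only [LinearConnection.ricci, Matrix.trace, Matrix.diag_apply, LinearMap.toMatrix_apply,
      ContinuousLinearMap.coe_coe]
    refine Finset.sum_congr rfl fun i _ ↦ ?_
    have hg := smoothField_globVec (Module.finBasis ℝ (TanAt n x) i)
    have := curvature_eq hcov hg hZ hY x
    rw [← hL _ hg, globVec_self] at this
    rw [this]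
  rw [h1, trace_eq_sum_coordCoef hx]
  refine Finset.sum_congr rfl fun i _ ↦ ?_
  have := hL _ (smoothField_globField x i)
  rw [globField_self] at this
  exact congrArg _ this

theorem smoothFnAt_trace_cov {Y : ∀ y : M, TanAt n y} (hY : SmoothField Y) (x : M) :
    (∀ᶠ y in 𝓝 x, LinearMap.trace ℝ (TanAt n y) (cov Y y).toLinearMap
      = ∑ i, coordCoef x i y (covField cov (globField x i) Y y)) ∧
    SmoothFnAt (n := n) (fun y ↦ LinearMap.trace ℝ (TanAt n y) (cov Y y).toLinearMap) x := by
  have h1 : ∀ᶠ y in 𝓝 x, LinearMap.trace ℝ (TanAt n y) (cov Y y).toLinearMap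
      = ∑ i, coordCoef x i y (covField cov (globField x i) Y y) := by
    filter_upwards [eventually_chart_source (n := n) x,
      Filter.eventually_all.2 (globField_eventually (n := n) x)] with y hy h
    rw [trace_eq_sum_coordCoef hy]
    simp [covField, h]
  refine ⟨h1, ContMDiffAt.congr_of_eventuallyEq ?_ h1⟩
  exact contMDiffAt_finsetSum fun i _ ↦
    smoothFnAt_coordCoef (smoothField_covField hcov (smoothField_globField x i) hY x) i

/-- The derivative of a trace is the trace of the covariant derivative. -/
theorem dirDeriv_trace_cov {Y : ∀ y : M, TanAt n y} (hY : SmoothField Y) (x : M) (v : TanAt n x) :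
    dirDeriv (fun y ↦ LinearMap.trace ℝ (TanAt n y) (cov Y y).toLinearMap) x v
      = ∑ i, coordCoef x i x (cov (covField cov (globField x i) Y) x v
        - cov Y x (cov (globField x i) x v)) := by
  have hx := mem_chart_source (ModelE n) x
  have hg := fun i ↦ smoothField_globField (n := n) x i
  have hW := fun i ↦ smoothField_covField hcov (hg i) hY x
  have ha := fun i j ↦ smoothFnAt_coordCoef (hW i) j
  have hcoef : ∀ i j, coordCoef (n := n) x i x (globField x j x) = if i = j then 1 else 0 := by
    intro i j
    rw [globField_self, coordCoef_coordField hx]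
  have h1 : ∀ i, cov (covField cov (globField x i) Y) x v
      = ∑ j, (coordCoef x j x (covField cov (globField x i) Y x) • cov (globField x j) x v
        + dirDeriv (fun y ↦ coordCoef x j y (covField cov (globField x i) Y y)) x v
          • globField x j x) := by
    intro i
    have hd : ∀ j, DiffFieldAt
        (fun y ↦ coordCoef x j y (covField cov (globField x i) Y y) • globField x j y) x :=
      fun j ↦ (SmoothFieldAt.smul (ha i j) (hg j x)).diff
    have h2 : ∀ᶠ y in 𝓝 x, covField cov (globField x i) Y y
        = ∑ j, coordCoef x j y (covField cov (globField x i) Y y) • globField x j y := by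
      filter_upwards [eventually_sum_coordCoef_smul x (covField cov (globField x i) Y),
        Filter.eventually_all.2 (globField_eventually (n := n) x)] with y hy h
      simp only [h]
      exact hy
    rw [cov_congr cov (MDifferentiableAt.sum_section fun j _ ↦ hd j) h2, cov_sum cov
      (X := fun j y ↦ coordCoef x j y (covField cov (globField x i) Y y) • globField x j y)
      fun j _ ↦ hd j, _root_.sum_apply]
    exact Finset.sum_congr rfl fun j _ ↦ cov_smul cov (ha i j).diff (hg j x).diff v
  have h3 : ∀ i, cov Y x (cov (globField x i) x v)
      = ∑ j, coordCoef x j x (cov (globField x i) x v) • covField cov (globField x j) Y x := by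
    intro i
    conv_lhs => rw [← sum_coordCoef_smul hx (cov (globField x i) x v)]
    simp [covField, globField_self]
  rw [dirDeriv_congr (smoothFnAt_trace_cov hcov hY x).1, dirDeriv_sum fun i _ ↦ (ha i i).diff]
  simp only [map_sub, h1, h3, map_sum, map_add, map_smul, hcoef, smul_eq_mul, mul_ite, mul_one,
    mul_zero, Finset.sum_add_distrib, Finset.sum_sub_distrib, Finset.sum_ite_eq, Finset.mem_univ,
    if_true]
  -- The remaining double sums are the traces of the matrix of `∇Y` times that of `∇_v` on the
  -- frame, in the two orders; exchanging the indices cancels them.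
  rw [Finset.sum_comm]
  simp only [mul_comm]
  ring

/-- Commutation of covariant derivatives, traced. -/
theorem trace_cov_cov {Y : ∀ y : M, TanAt n y} (hY : SmoothField Y) (x : M) :
    LinearMap.trace ℝ (TanAt n x) (cov (covField cov Y Y) x).toLinearMap
      = cov.ricci x (Y x) (Y x)
        + dirDeriv (fun y ↦ LinearMap.trace ℝ (TanAt n y) (cov Y y).toLinearMap) x (Y x)
        + LinearMap.trace ℝ (TanAt n x) ((cov Y x).toLinearMap ∘ₗ (cov Y x).toLinearMap)
        + LinearMap.trace ℝ (TanAt n x)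
          ((cov Y x).toLinearMap ∘ₗ (cov.torsion x (Y x)).toLinearMap) := by
  have hx := mem_chart_source (ModelE n) x
  have hg := fun i ↦ smoothField_globField (n := n) x i
  rw [dirDeriv_trace_cov hcov hY, ricci_eq_sum hcov hY hY, trace_eq_sum_coordCoef hx,
    trace_eq_sum_coordCoef hx, trace_eq_sum_coordCoef hx, ← Finset.sum_add_distrib,
    ← Finset.sum_add_distrib, ← Finset.sum_add_distrib]
  refine Finset.sum_congr rfl fun i _ ↦ ?_
  have ht := cov.torsion_apply (hY x).diff (hg i x).diff
  -- With the bracket in this form, `-∇_{[E_i, Y]} Y` in the curvature accounts for `A²`, for `A ∘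
  -- T_∇(Y, ·)` and for the frame correction in the derivative of `tr A`.
  have hb : bracket (globField x i) Y x
      = cov Y x (globField x i x) - cov (globField x i) x (Y x)
        + cov.torsion x (Y x) (globField x i x) := by
    rw [ht]
    simp only [bracket]
    rw [mlieBracket_swap_apply]
    abel
  simp only [curvField, hb, map_sub, map_add, ← globField_self x i, LinearMap.comp_apply,
    ContinuousLinearMap.coe_coe]
  ring

end bochner

/-! ### Torsion and the asymmetry of the Hessian. -/

section torsion
variable {n : ℕ} {M : Type*} [TopologicalSpace M] [ChartedSpace (ModelE n) M]
  [IsManifold (𝓡 (2 * n + 1)) ∞ M] (cov : LinearConnection n M) {x : M}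

theorem LinearConnection.torsion_swap (u v : TanAt n x) :
    cov.torsion x u v = - cov.torsion x v u := by
  have h1 := cov.torsion_apply (smoothFieldAt_extendVec u).diff (smoothFieldAt_extendVec v).diff
  have h2 := cov.torsion_apply (smoothFieldAt_extendVec v).diff (smoothFieldAt_extendVec u).diff
  simp only [FiberBundle.extend_apply_self] at h1 h2
  rw [h1, h2, mlieBracket_swap_apply]
  abel

theorem LinearConnection.hessian_swap {f : M → ℝ} (hf : SmoothFnAt (n := n) f x) (u v : TanAt n x) :
    cov.hessian f x u v = cov.hessian f x v u - dirDeriv f x (cov.torsion x u v) := by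
  have hU := smoothFieldAt_extendVec u
  have hV := smoothFieldAt_extendVec v
  have h1 := cov.torsion_apply hU.diff hV.diff
  have h2 := dirDeriv_bracket hf hU hV
  simp only [FiberBundle.extend_apply_self, bracket] at h1 h2
  rw [h1, map_sub, map_sub, h2]
  simp only [LinearConnection.hessian]
  ring

end torsion

/-! ### Smoothness of fields defined by linear equations. -/

section smoothness
variable {n : ℕ} {M : Type*} [TopologicalSpace M] [ChartedSpace (ModelE n) M]
  [IsManifold (𝓡 (2 * n + 1)) ∞ M]

theorem IsSmoothOneForm.smoothFnAt_apply {θ : ∀ x : M, TanAt n x →L[ℝ] ℝ} (hθ : IsSmoothOneForm θ)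
    {X : ∀ y : M, TanAt n y} {x : M} (hX : SmoothFieldAt X x) :
    SmoothFnAt (n := n) (fun y ↦ θ y (X y)) x := by
  have := ContMDiffAt.clm_bundle_apply (F₁ := ModelE n) (F₂ := ℝ)
    (E₁ := fun y : M ↦ TangentSpace (𝓡 (2 * n + 1)) y)
    (E₂ := fun x : M ↦ Bundle.Trivial M ℝ x) (b := fun y : M ↦ y) (ϕ := fun y ↦ θ y)
    (v := fun y ↦ X y) (hθ x) hX
  rw [contMDiffAt_totalSpace] at this
  exact this.2

/-- A vector field whose contraction with a nondegenerate smooth bilinear form is smooth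
is smooth. -/
theorem smoothFieldAt_of_bilin {B : ∀ y : M, TanAt n y →ₗ[ℝ] TanAt n y →ₗ[ℝ] ℝ}
    {Y : ∀ y : M, TanAt n y} {x : M}
    (hB : ∀ i j, SmoothFnAt (n := n) (fun y ↦ B y (coordField x i y) (coordField x j y)) x)
    (hY : ∀ i, SmoothFnAt (n := n) (fun y ↦ B y (Y y) (coordField x i y)) x)
    (hnd : ∀ u, (∀ v, B x u v = 0) → u = 0) : SmoothFieldAt Y x := by
  have hx := mem_chart_source (ModelE n) x
  have hdet : (Matrix.of fun i j ↦ B x (coordField x j x) (coordField x i x)).det ≠ 0 := by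
    intro h0
    obtain ⟨c, hc, hc0⟩ := Matrix.exists_mulVec_eq_zero_iff.2 h0
    refine hc ?_
    have hu : ∑ j, c j • coordField x j x = 0 := by
      refine hnd _ fun v ↦ ?_
      rw [← sum_coordCoef_smul hx v, map_sum]
      refine Finset.sum_eq_zero fun i _ ↦ ?_
      have := congrFun hc0 i
      simp only [Matrix.mulVec, dotProduct, Matrix.of_apply, Pi.zero_apply] at this
      rw [map_smul, map_sum, LinearMap.sum_apply]
      simp only [map_smul, LinearMap.smul_apply, smul_eq_mul]
      rw [Finset.sum_congr rfl fun j _ ↦ mul_comm (c j) _, this, mul_zero]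
    ext i
    have := congrArg (coordCoef x i x) hu
    simpa [coordCoef_coordField hx] using this
  have hc := smoothFnAt_of_linear_system (n := n) (x := x)
    (G := fun y ↦ Matrix.of fun i j ↦ B y (coordField x j y) (coordField x i y))
    (c := fun y i ↦ coordCoef x i y (Y y)) (b := fun y i ↦ B y (Y y) (coordField x i y))
    (fun i j ↦ hB j i) hY hdet (by
      filter_upwards [eventually_chart_source (n := n) x] with y hy
      ext i
      conv_rhs => rw [← sum_coordCoef_smul hy (Y y)]
      simp [Matrix.mulVec, dotProduct, mul_comm])
  exact (SmoothFieldAt.sum (X := fun i y ↦ coordCoef x i y (Y y) • coordField x i y)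
    fun i (_ : i ∈ Finset.univ) ↦ SmoothFieldAt.smul (hc i) (smoothFieldAt_coordField hx i)).congr
      (eventually_sum_coordCoef_smul x Y)

end smoothness

/-! ### Pseudohermitian geometry: `dθ`, `J`, the Webster metric and gradients. -/

namespace StrictlyPseudoconvexStructure

variable {n : ℕ} {M : Type*} [TopologicalSpace M]
  [ChartedSpace (ModelE n) M] [IsManifold (𝓡 (2 * n + 1)) ∞ M] {S : CRStructure n M}
  (P : StrictlyPseudoconvexStructure S)

theorem smoothFnAt_dθ {U V : ∀ y : M, TanAt n y} {x : M} (hU : SmoothFieldAt U x)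
    (hV : SmoothFieldAt V x) : SmoothFnAt (n := n) (fun y ↦ P.dθ y (U y) (V y)) x := by
  have h : ∀ᶠ y in 𝓝 x, P.dθ y (U y) (V y) = (1 / 2) * (dirDeriv (fun y ↦ P.θ y (V y)) y (U y)
      - dirDeriv (fun y ↦ P.θ y (U y)) y (V y) - P.θ y (bracket U V y)) := by
    filter_upwards [hU.eventually_diff, hV.eventually_diff] with y h1 h2
    exact extDerivForm_apply P.smooth h1 h2
  refine ContMDiffAt.congr_of_eventuallyEq ?_ h
  have h1 := (P.smooth.smoothFnAt_apply hV).dirDeriv hU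
  have h2 := (P.smooth.smoothFnAt_apply hU).dirDeriv hV
  have h3 := P.smooth.smoothFnAt_apply (hU.bracket hV)
  exact contMDiffAt_const.mul ((h1.sub h2).sub h3)

theorem Jext_mem (x : M) (v : TanAt n x) : P.Jext x v ∈ S.H x := (S.J x (P.projH x v)).2

theorem projH_of_mem {x : M} {v : TanAt n x} (hv : v ∈ S.H x) : P.projH x v = ⟨v, hv⟩ := by
  ext1
  rw [projH_apply, P.mem_H_iff.1 hv]
  simp

theorem Jext_of_mem {x : M} {v : TanAt n x} (hv : v ∈ S.H x) :
    P.Jext x v = S.J x ⟨v, hv⟩ := by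
  simp [Jext, P.projH_of_mem hv]

theorem Jext_Jext (x : M) (v : TanAt n x) : P.Jext x (P.Jext x v) = -(P.projH x v : TanAt n x) := by
  rw [P.Jext_of_mem (P.Jext_mem x v)]
  exact congrArg Subtype.val (S.J_sq x (P.projH x v))

theorem projH_add_reeb (x : M) (v : TanAt n x) :
    (P.projH x v : TanAt n x) + P.θ x v • P.reeb x = v := by
  rw [projH_apply]; abel

theorem Jext_reeb (x : M) : P.Jext x (P.reeb x) = 0 := by
  have : P.projH x (P.reeb x) = 0 := by
    ext1
    rw [projH_apply, theta_reeb]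
    simp
  simp [Jext, this]

theorem theta_Jext (x : M) (v : TanAt n x) : P.θ x (P.Jext x v) = 0 :=
  P.mem_H_iff.1 (P.Jext_mem x v)

theorem dθ_reeb_right (x : M) (v : TanAt n x) : P.dθ x v (P.reeb x) = 0 := by
  rw [dθ_swap, dθ_reeb, neg_zero]

theorem dθ_projH_left (x : M) (u v : TanAt n x) : P.dθ x (P.projH x u) v = P.dθ x u v := by
  rw [projH_apply]
  simp [dθ_reeb]

theorem dθ_projH_right (x : M) (u v : TanAt n x) : P.dθ x u (P.projH x v) = P.dθ x u v := by
  rw [projH_apply]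
  simp [dθ_reeb_right]

/-- Since `T ⌟ dθ = 0`, the projections in the definition can be absorbed into the extended `J`. -/
theorem webster_eq (x : M) (u v : TanAt n x) :
    P.webster x u v = P.dθ x u (P.Jext x v) + P.θ x u * P.θ x v := by
  rw [webster_apply, PseudohermitianStructure.leviForm, dθ_projH_left]
  rfl

/-- `T` was chosen point by point, but it solves `B(T, ·) = θ` for the smooth form `B = dθ + θ ⊗ θ`.
This form is nondegenerate: if `B(u, ·) = 0`, then `B(u, u) = θ(u)²` forces `u` to be horizontal,
and then `B(u, Ju) = g_θ(u, u)` forces `u = 0`. -/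
theorem smoothFieldAt_reeb (x : M) : SmoothFieldAt P.reeb x := by
  let B : ∀ y : M, TanAt n y →ₗ[ℝ] TanAt n y →ₗ[ℝ] ℝ := fun y ↦
    LinearMap.mk₂ ℝ (fun u v ↦ P.dθ y u v + P.θ y u * P.θ y v)
      (by intro u u' v; simp; ring) (by intro c u v; simp; ring)
      (by intro u v v'; simp; ring) (by intro c u v; simp; ring)
  have hx := mem_chart_source (ModelE n) x
  have hE := fun i ↦ smoothFieldAt_coordField hx i
  refine smoothFieldAt_of_bilin (B := B) (fun i j ↦ ?_) (fun i ↦ ?_) fun u hu ↦ ?_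
  · exact (P.smoothFnAt_dθ (hE i) (hE j)).add
      ((P.smooth.smoothFnAt_apply (hE i)).mul (P.smooth.smoothFnAt_apply (hE j)))
  · simp only [B, LinearMap.mk₂_apply, dθ_reeb, theta_reeb, one_mul, zero_add]
    exact P.smooth.smoothFnAt_apply (hE i)
  · have hu' : ∀ v, P.dθ x u v + P.θ x u * P.θ x v = 0 := hu
    have h1 : P.dθ x u u = 0 := by have := P.dθ_swap x u u; linarith
    have h2 := hu' u
    rw [h1, zero_add] at h2
    have h3 : P.θ x u = 0 := mul_self_eq_zero.1 h2
    by_contra hne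
    have h4 := P.webster_pos x u hne
    have h5 := hu' (P.Jext x u)
    rw [webster_eq, h3] at h4
    rw [h3] at h5
    linarith

theorem smoothFieldAt_projH {V : ∀ y : M, TanAt n y} {x : M} (hV : SmoothFieldAt V x) :
    SmoothFieldAt (fun y ↦ (P.projH y (V y) : TanAt n y)) x :=
  SmoothFieldAt.sub hV (SmoothFieldAt.smul (P.smooth.smoothFnAt_apply hV) (P.smoothFieldAt_reeb x))

theorem smoothFieldAt_Jext {V : ∀ y : M, TanAt n y} {x : M} (hV : SmoothFieldAt V x) :
    SmoothFieldAt (fun y ↦ P.Jext y (V y)) x :=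
  S.J_smooth x (fun y ↦ P.projH y (V y)) (P.smoothFieldAt_projH hV)

theorem smoothFnAt_webster {U V : ∀ y : M, TanAt n y} {x : M} (hU : SmoothFieldAt U x)
    (hV : SmoothFieldAt V x) : SmoothFnAt (n := n) (fun y ↦ P.webster y (U y) (V y)) x := by
  simp only [webster_eq]
  exact (P.smoothFnAt_dθ hU (P.smoothFieldAt_Jext hV)).add
      ((P.smooth.smoothFnAt_apply hU).mul (P.smooth.smoothFnAt_apply hV))

theorem smoothFieldAt_grad {f : M → ℝ} {x : M} (hf : SmoothFnAt (n := n) f x) :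
    SmoothFieldAt (P.grad f) x := by
  have hx := mem_chart_source (ModelE n) x
  have hE := fun i ↦ smoothFieldAt_coordField hx i
  refine smoothFieldAt_of_bilin (B := P.webster)
    (fun i j ↦ P.smoothFnAt_webster (hE i) (hE j)) (fun i ↦ ?_) (P.webster_nondegenerate x).1
  simp only [webster_grad]
  exact hf.dirDeriv (hE i)

theorem smoothFieldAt_gradH {f : M → ℝ} {x : M} (hf : SmoothFnAt (n := n) f x) :
    SmoothFieldAt (P.gradH f) x :=
  P.smoothFieldAt_projH (P.smoothFieldAt_grad hf)

/-- A horizontal extension of a horizontal vector, smooth at the base point. -/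
def horizExtend {x : M} (v : TanAt n x) (y : M) : S.H y := P.projH y (extendVec v y)

theorem horizExtend_self {x : M} {v : TanAt n x} (hv : v ∈ S.H x) :
    (P.horizExtend v x : TanAt n x) = v := by
  have : extendVec v x = v := by simp
  rw [horizExtend, this, P.projH_of_mem hv]

theorem smoothFieldAt_horizExtend {x : M} (v : TanAt n x) :
    SmoothFieldAt (fun y ↦ (P.horizExtend v y : TanAt n y)) x :=
  P.smoothFieldAt_projH (smoothFieldAt_extendVec v)

theorem dθ_of_horizontal {U V : ∀ y : M, S.H y} {x : M}
    (hU : DiffFieldAt (fun y ↦ (U y : TanAt n y)) x)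
    (hV : DiffFieldAt (fun y ↦ (V y : TanAt n y)) x) :
    P.dθ x (U x) (V x)
      = -(1 / 2) * P.θ x (bracket (fun y ↦ (U y : TanAt n y)) (fun y ↦ (V y : TanAt n y)) x) := by
  have h1 : ∀ W : ∀ y : M, S.H y, (fun y ↦ P.θ y (W y : TanAt n y)) = fun _ ↦ (0 : ℝ) := fun W ↦ by
    ext y
    exact P.mem_H_iff.1 (W y).2
  have h2 := extDerivForm_apply P.smooth hU hV
  rw [h1, h1, dirDeriv_const, dirDeriv_const] at h2
  rw [PseudohermitianStructure.dθ, h2]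
  ring

/-- The Levi form is `J`-invariant. -/
theorem dθ_Jext_Jext_of_mem {x : M} {u v : TanAt n x} (hu : u ∈ S.H x) (hv : v ∈ S.H x) :
    P.dθ x (P.Jext x u) (P.Jext x v) = P.dθ x u v := by
  have hU := P.smoothFieldAt_horizExtend u
  have hV := P.smoothFieldAt_horizExtend v
  have hJU := S.J_smooth x _ hU
  have hJV := S.J_smooth x _ hV
  -- Integrability makes `[U, V] - [JU, JV]` horizontal, so `θ` takes the same value on both
  -- brackets; on horizontal fields `dθ` is `-½ θ` of the bracket.
  obtain ⟨hR, -⟩ := S.integrable x _ _ hU hV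
  have h0 := P.mem_H_iff.1 hR
  rw [map_sub] at h0
  have h1 := P.dθ_of_horizontal hU.diff hV.diff
  have h2 := P.dθ_of_horizontal (U := fun y ↦ S.J y (P.horizExtend u y))
    (V := fun y ↦ S.J y (P.horizExtend v y)) hJU.diff hJV.diff
  rw [P.horizExtend_self hu, P.horizExtend_self hv] at h1
  have e : ∀ {w : TanAt n x} (hw : w ∈ S.H x), P.Jext x w = S.J x (P.horizExtend w x) := by
    intro w hw
    rw [P.Jext_of_mem hw]
    congr 2
    exact Subtype.ext (P.horizExtend_self hw).symm
  rw [e hu, e hv, h1, h2]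
  linarith

theorem dθ_Jext_Jext (x : M) (u v : TanAt n x) :
    P.dθ x (P.Jext x u) (P.Jext x v) = P.dθ x u v := by
  have h := P.dθ_Jext_Jext_of_mem (P.projH x u).2 (P.projH x v).2
  have e : ∀ w, P.Jext x (P.projH x w) = P.Jext x w := fun w ↦ by
    rw [P.Jext_of_mem (P.projH x w).2]; rfl
  rwa [dθ_projH_left, dθ_projH_right, e, e] at h

/-- Symmetry is not built into the definition: it comes from the `J`-invariance of `dθ`, hence from
integrability. -/
theorem webster_symm (x : M) (u v : TanAt n x) : P.webster x u v = P.webster x v u := by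
  rw [webster_eq, webster_eq, ← P.dθ_Jext_Jext x u, Jext_Jext, map_neg, dθ_projH_right,
    P.dθ_swap x v]
  ring

/-- The relation between `dθ` and the Webster metric. -/
theorem webster_Jext_right (x : M) (u v : TanAt n x) :
    P.webster x u (P.Jext x v) = - P.dθ x u v := by
  rw [webster_eq, Jext_Jext, map_neg, dθ_projH_right, theta_Jext]
  ring

theorem webster_Jext_left (x : M) (u v : TanAt n x) :
    P.webster x (P.Jext x u) v = - P.webster x u (P.Jext x v) := by
  rw [webster_symm, webster_Jext_right, webster_Jext_right, dθ_swap]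

theorem webster_reeb_right (x : M) (u : TanAt n x) : P.webster x u (P.reeb x) = P.θ x u := by
  rw [webster_eq, Jext_reeb, theta_reeb]
  simp

theorem eq_of_webster_eq {x : M} {u v : TanAt n x} (hu : u ∈ S.H x) (hv : v ∈ S.H x)
    (h : ∀ w ∈ S.H x, P.webster x u w = P.webster x v w) : u = v := by
  by_contra hne
  have hm := (S.H x).sub_mem hu hv
  have := P.webster_pos x (u - v) (sub_ne_zero.2 hne)
  have h1 := h _ hm
  simp only [map_sub, LinearMap.sub_apply] at this h1
  linarith

theorem gradH_mem (f : M → ℝ) (x : M) : P.gradH f x ∈ S.H x := (P.projH x (P.grad f x)).2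

theorem webster_gradH (f : M → ℝ) {x : M} {v : TanAt n x} (hv : v ∈ S.H x) :
    P.webster x (P.gradH f x) v = dirDeriv f x v := by
  rw [← webster_grad, webster_eq, webster_eq, gradH, dθ_projH_left, P.mem_H_iff.1 hv]
  simp

theorem grad_eq (f : M → ℝ) (x : M) :
    P.grad f x = P.gradH f x + dirDeriv f x (P.reeb x) • P.reeb x := by
  rw [← webster_grad, webster_reeb_right, gradH, projH_add_reeb]

end StrictlyPseudoconvexStructure

/-! ### Orthonormal horizontal frames and traces. -/

namespace StrictlyPseudoconvexStructure

variable {n : ℕ} {M : Type*} [TopologicalSpace M]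
  [ChartedSpace (ModelE n) M] [IsManifold (𝓡 (2 * n + 1)) ∞ M] {S : CRStructure n M}
  {P : StrictlyPseudoconvexStructure S}

section frame

variable {x : M} {X : Fin (2 * n) → TanAt n x}

theorem finrank_H (S : CRStructure n M) (x : M) : Module.finrank ℝ (S.H x) = 2 * n := by
  obtain ⟨s, hs⟩ := S.exists_frame x
  obtain ⟨-, hli, hsp⟩ := hs.self_of_nhds
  rw [← hsp, finrank_span_eq_card hli, Fintype.card_fin]

theorem IsOrthonormalFrameH.webster_sum (hX : P.IsOrthonormalFrameH x X) (c : Fin (2 * n) → ℝ)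
    (k : Fin (2 * n)) : P.webster x (∑ j, c j • X j) (X k) = c k := by
  simp [hX.2]

theorem IsOrthonormalFrameH.sum_webster_smul (hX : P.IsOrthonormalFrameH x X) {v : TanAt n x}
    (hv : v ∈ S.H x) : ∑ k, P.webster x v (X k) • X k = v := by
  have hli : LinearIndependent ℝ X := by
    rw [Fintype.linearIndependent_iff]
    intro c hc k
    rw [← hX.webster_sum c k, hc]
    simp
  have hsp : Submodule.span ℝ (Set.range X) = S.H x := by
    refine Submodule.eq_of_le_of_finrank_eq (Submodule.span_le.2 ?_) ?_
    · rintro _ ⟨j, rfl⟩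
      exact hX.1 j
    · rw [finrank_H, finrank_span_eq_card hli, Fintype.card_fin]
  rw [← hsp] at hv
  obtain ⟨c, rfl⟩ := (Submodule.mem_span_range_iff_exists_fun ℝ).1 hv
  simp only [hX.webster_sum]

/-- Adding `T` completes the frame to an orthonormal basis of the tangent space, in which `L` is a
sum of rank-one maps. -/
theorem IsOrthonormalFrameH.trace_eq (hX : P.IsOrthonormalFrameH x X)
    (L : TanAt n x →ₗ[ℝ] TanAt n x) :
    LinearMap.trace ℝ (TanAt n x) L
      = ∑ k, P.webster x (L (X k)) (X k) + P.θ x (L (P.reeb x)) := by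
  have h : L = ∑ k, ((P.webster x).flip (X k)).smulRight (L (X k))
      + (P.θ x).toLinearMap.smulRight (L (P.reeb x)) := by
    ext v
    have e : P.webster x v = P.webster x (P.projH x v) + P.θ x v • P.webster x (P.reeb x) := by
      conv_lhs => rw [← P.projH_add_reeb x v, map_add, map_smul]
    have hk : ∀ k, P.webster x v (X k) = P.webster x (P.projH x v) (X k) := fun k ↦ by
      rw [e, LinearMap.add_apply, LinearMap.smul_apply, P.webster_symm x (P.reeb x),
        webster_reeb_right, P.mem_H_iff.1 (hX.1 k)]
      simp
    conv_lhs => rw [← P.projH_add_reeb x v, map_add, map_smul,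
      ← hX.sum_webster_smul (P.projH x v).2, map_sum]
    simp [hk]
  conv_lhs => rw [h]
  rw [map_add, map_sum]
  simp only [LinearMap.trace_smulRight]
  rfl

end frame

variable {cov : LinearConnection n M}

/-! ### Torsion, divergence and Hessian of the Tanaka-Webster connection. -/

namespace IsTanakaWebster

variable (hcov : P.IsTanakaWebster cov) {x : M}
include hcov

theorem cov_mem {Y : ∀ y : M, TanAt n y} (hY : ∀ y, Y y ∈ S.H y) (hd : DiffFieldAt Y x)
    (v : TanAt n x) : cov Y x v ∈ S.H x :=
  hcov.parallel_H x (fun y ↦ ⟨Y y, hY y⟩) hd v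

theorem cov_Jext {Y : ∀ y : M, TanAt n y} (hY : ∀ y, Y y ∈ S.H y) (hd : DiffFieldAt Y x)
    (v : TanAt n x) : cov (fun y ↦ P.Jext y (Y y)) x v = P.Jext x (cov Y x v) := by
  have := hcov.parallel_J x (fun y ↦ ⟨Y y, hY y⟩) hd v
  rw [← this]
  congr 2
  ext1 y
  rw [P.Jext_of_mem (hY y)]

/-- The characteristic direction is parallel. -/
theorem cov_reeb (v : TanAt n x) : cov P.reeb x v = 0 := by
  have hT := (P.smoothFieldAt_reeb x).diff
  have h1 := hcov.parallel_g x _ _ hT hT v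
  simp only [webster_reeb_right, theta_reeb, dirDeriv_const] at h1
  rw [P.webster_symm x (P.reeb x), webster_reeb_right] at h1
  -- Differentiating `g_θ(T, T) = 1` shows that `∇_v T` is horizontal. It is also orthogonal to
  -- `H(M)`, by differentiating `g_θ(T, W) = 0` for horizontal `W`, whose derivative stays
  -- horizontal.
  have h2 : cov P.reeb x v ∈ S.H x := by
    rw [P.mem_H_iff]
    linarith
  refine P.eq_of_webster_eq h2 (S.H x).zero_mem fun w hw ↦ ?_
  have hW := (P.smoothFieldAt_horizExtend w).diff
  have h3 := hcov.parallel_g x _ _ hT hW v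
  have h4 : ∀ y, ∀ u ∈ S.H y, P.webster y (P.reeb y) u = 0 := fun y u hu ↦ by
    rw [webster_symm, webster_reeb_right, P.mem_H_iff.1 hu]
  rw [h4 x _ (hcov.parallel_H x _ hW v), P.horizExtend_self hw] at h3
  have h5 : (fun y ↦ P.webster y (P.reeb y) (P.horizExtend w y : TanAt n y)) = fun _ ↦ (0 : ℝ) := by
    ext y
    exact h4 y _ (P.horizExtend w y).2
  rw [h5, dirDeriv_const] at h3
  rw [map_zero, LinearMap.zero_apply]
  linarith

/-- The torsion on horizontal vectors. -/
theorem torsion_of_mem {u v : TanAt n x} (hu : u ∈ S.H x) (hv : v ∈ S.H x) :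
    cov.torsion x u v = (2 * P.dθ x u v) • P.reeb x := by
  -- The real parts of the two torsion conditions say that `T_∇(u, v) - T_∇(Ju, Jv)` is zero and
  -- that `T_∇(u, v) + T_∇(Ju, Jv)` is `4 dθ(u, v) T`; half their sum is the claim.
  have h1 := congrArg Prod.fst (hcov.torsion_hol x ⟨u, hu⟩ ⟨v, hv⟩)
  have h2 := congrArg Prod.fst (hcov.torsion_mixed x ⟨u, hu⟩ ⟨v, hv⟩)
  simp only [complexExt, holVec, antiholVec, map_neg, _root_.neg_apply, neg_neg,
    Prod.fst_zero, ← P.Jext_of_mem hu, ← P.Jext_of_mem hv, sub_neg_eq_add, LinearMap.neg_apply,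
    webster_Jext_left, webster_Jext_right] at h1 h2
  have h3 : (2 : ℝ) • cov.torsion x u v = (4 * P.dθ x u v) • P.reeb x := by
    rw [two_smul]
    calc _ = (cov.torsion x u v - cov.torsion x (P.Jext x u) (P.Jext x v))
          + (cov.torsion x u v + cov.torsion x (P.Jext x u) (P.Jext x v)) := by abel
      _ = _ := by
        rw [h1, h2, zero_add]
        congr 1
        ring
  calc cov.torsion x u v = (1 / 2 : ℝ) • (2 : ℝ) • cov.torsion x u v := by
        rw [smul_smul]; norm_num
    _ = _ := by
        rw [h3, smul_smul]
        congr 1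
        ring

/-- From `τ J = -J τ`, the values of `τ` on the image of `J`, which is all of `H(M)`, are
horizontal; and `τ(T) = 0`. -/
theorem torsion_reeb_mem (v : TanAt n x) : cov.torsion x (P.reeb x) v ∈ S.H x := by
  have key : ∀ w, cov.torsion x (P.reeb x) (P.Jext x w) ∈ S.H x := fun w ↦ by
    rw [eq_neg_of_add_eq_zero_left (hcov.torsion_J x w)]
    exact (S.H x).neg_mem (P.Jext_mem x _)
  have h0 : cov.torsion x (P.reeb x) (P.reeb x) = 0 := by
    have hT := (P.smoothFieldAt_reeb x).diff
    rw [cov.torsion_apply hT hT, hcov.cov_reeb]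
    simp
  rw [← P.projH_add_reeb x v, map_add, map_smul, h0, smul_zero, add_zero,
    ← neg_neg (P.projH x v : TanAt n x), ← P.Jext_Jext, map_neg]
  exact (S.H x).neg_mem (key _)

theorem torsion_eq {u : TanAt n x} (hu : u ∈ S.H x) :
    (cov.torsion x u).toLinearMap
      = ((2 : ℝ) • (P.dθ x u).toLinearMap).smulRight (P.reeb x)
        - (P.θ x).toLinearMap.smulRight (cov.torsion x (P.reeb x) u) := by
  ext v
  have h := hcov.torsion_of_mem hu (P.projH x v).2
  rw [dθ_projH_right] at h
  conv_lhs => rw [← P.projH_add_reeb x v]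
  simp only [ContinuousLinearMap.coe_coe, map_add, map_smul, h,
    LinearConnection.torsion_swap cov u (P.reeb x)]
  simp [sub_eq_add_neg]

/-- Both rank-one pieces of `torsion_eq` are traceless: `dθ(u, T) = 0`, and `τ(u)` is horizontal. -/
theorem trace_torsion {u : TanAt n x} (hu : u ∈ S.H x) :
    LinearMap.trace ℝ (TanAt n x) (cov.torsion x u).toLinearMap = 0 := by
  rw [hcov.torsion_eq hu, map_sub, LinearMap.trace_smulRight, LinearMap.trace_smulRight]
  simp [dθ_reeb_right, P.mem_H_iff.1 (hcov.torsion_reeb_mem u)]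

theorem divergence_eq {Y : ∀ y : M, TanAt n y} (hY : SmoothFieldAt Y x) (hYH : Y x ∈ S.H x) :
    divergence P.webster Y x = LinearMap.trace ℝ (TanAt n x) (cov Y x).toLinearMap := by
  have hx := mem_chart_source (ModelE n) x
  rw [divergence_eq_trace cov (P.webster_symm x) (P.webster_pos x)
    (fun i j ↦ P.smoothFnAt_webster (smoothFieldAt_coordField hx i) (smoothFieldAt_coordField hx j))
    (hcov.parallel_g x) hY, map_add, hcov.trace_torsion hYH, add_zero]

theorem sublaplacian_eq {f : M → ℝ} (hf : SmoothFnAt (n := n) f x) :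
    P.sublaplacian f x = LinearMap.trace ℝ (TanAt n x) (cov (P.gradH f) x).toLinearMap :=
  hcov.divergence_eq (P.smoothFieldAt_gradH hf) (P.gradH_mem f x)

theorem cov_grad {f : M → ℝ} (hf : SmoothFnAt (n := n) f x) (v : TanAt n x) :
    cov (P.grad f) x v = cov (P.gradH f) x v
      + dirDeriv (fun y ↦ dirDeriv f y (P.reeb y)) x v • P.reeb x := by
  have h1 : P.grad f = fun y ↦ P.gradH f y + dirDeriv f y (P.reeb y) • P.reeb y := by
    ext1 y
    exact P.grad_eq f y
  have hT := P.smoothFieldAt_reeb x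
  have hTf := hf.dirDeriv hT
  have hd : DiffFieldAt (fun y ↦ dirDeriv f y (P.reeb y) • P.reeb y) x :=
    (SmoothFieldAt.smul hTf hT).diff
  rw [h1, cov_add cov (P.smoothFieldAt_gradH hf).diff hd,
    _root_.add_apply, cov_smul cov hTf.diff hT.diff, hcov.cov_reeb, smul_zero, zero_add]

/-- The full gradient is `∇^H f + (Tf) T` with `T` parallel, so the vertical part contributes only a
multiple of `T`, orthogonal to `v`. -/
theorem hessian_eq {f : M → ℝ} (hf : SmoothFnAt (n := n) f x) (u : TanAt n x) {v : TanAt n x}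
    (hv : v ∈ S.H x) : cov.hessian f x u v = P.webster x (cov (P.gradH f) x u) v := by
  have h1 := hcov.parallel_g x _ _ (P.smoothFieldAt_grad hf).diff
    (smoothFieldAt_extendVec v).diff u
  simp only [webster_grad, FiberBundle.extend_apply_self] at h1
  rw [LinearConnection.hessian, h1, add_sub_cancel_right, hcov.cov_grad hf, map_add,
    LinearMap.add_apply, map_smul, LinearMap.smul_apply, P.webster_symm x (P.reeb x),
    webster_reeb_right, P.mem_H_iff.1 hv]
  simp

theorem hessian_swap_of_mem {f : M → ℝ} (hf : SmoothFnAt (n := n) f x) {u v : TanAt n x}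
    (hu : u ∈ S.H x) (hv : v ∈ S.H x) :
    cov.hessian f x u v
      = cov.hessian f x v u + 2 * P.webster x u (P.Jext x v) * dirDeriv f x (P.reeb x) := by
  rw [LinearConnection.hessian_swap cov hf, hcov.torsion_of_mem hu hv, webster_Jext_right, map_smul,
    smul_eq_mul]
  ring

end IsTanakaWebster

end StrictlyPseudoconvexStructure

/-! ### The terms of the Bochner formula. -/

namespace StrictlyPseudoconvexStructure

variable {n : ℕ} {M : Type*} [TopologicalSpace M]
  [ChartedSpace (ModelE n) M] [IsManifold (𝓡 (2 * n + 1)) ∞ M] {S : CRStructure n M}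
  {P : StrictlyPseudoconvexStructure S} {cov : LinearConnection n M}

namespace IsTanakaWebster

variable (hcov : P.IsTanakaWebster cov) {x : M} {f : M → ℝ}
include hcov

/-- The horizontal gradient of the squared length of the horizontal gradient. -/
theorem gradH_sq (hf : SmoothFnAt (n := n) f x) :
    P.gradH (fun y ↦ P.webster y (P.gradH f y) (P.gradH f y)) x
      = (2 : ℝ) • (cov (P.gradH f) x (P.gradH f x)
        + (2 * dirDeriv f x (P.reeb x)) • P.Jext x (P.gradH f x)) := by
  have hd := (P.smoothFieldAt_gradH hf).diff
  have hm := P.gradH_mem f x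
  refine P.eq_of_webster_eq (P.gradH_mem _ x) ((S.H x).smul_mem _ ((S.H x).add_mem
    (hcov.cov_mem (P.gradH_mem f) hd _) ((S.H x).smul_mem _ (P.Jext_mem x _)))) fun v hv ↦ ?_
  -- Metric compatibility gives `v(|Y|²) = 2 Hess(v, Y)`. Swapping the arguments puts `v` in the
  -- slot where it pairs with `∇_Y Y`, and the torsion term becomes the multiple of `JY`.
  have h1 := hcov.hessian_swap_of_mem hf hv hm
  rw [hcov.hessian_eq hf _ hv, hcov.hessian_eq hf _ hm] at h1
  rw [P.webster_gradH _ hv, hcov.parallel_g x _ _ hd hd, P.webster_symm x (P.gradH f x), h1]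
  simp only [map_smul, map_add, LinearMap.smul_apply, LinearMap.add_apply, smul_eq_mul]
  rw [P.webster_symm x v]
  ring

theorem trace_cov_smul_Jext {a : M → ℝ} (ha : SmoothFnAt (n := n) a x) {Y : ∀ y : M, TanAt n y}
    (hY : SmoothFieldAt Y x) (hYH : ∀ y, Y y ∈ S.H y) :
    LinearMap.trace ℝ (TanAt n x) (cov (fun y ↦ a y • P.Jext y (Y y)) x).toLinearMap
      = a x * LinearMap.trace ℝ (TanAt n x) (P.Jext x ∘ₗ (cov Y x).toLinearMap)
        + dirDeriv a x (P.Jext x (Y x)) := by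
  have h : (cov (fun y ↦ a y • P.Jext y (Y y)) x).toLinearMap
      = a x • (P.Jext x ∘ₗ (cov Y x).toLinearMap)
        + (dirDeriv a x).toLinearMap.smulRight (P.Jext x (Y x)) := by
    ext v
    simp only [ContinuousLinearMap.coe_coe]
    rw [cov_smul cov ha.diff (P.smoothFieldAt_Jext hY).diff, hcov.cov_Jext hYH hY.diff]
    rfl
  rw [h, map_add, map_smul, LinearMap.trace_smulRight]
  rfl

/-- The piece of the torsion containing `τ` has trace `θ(L(τ u))` up to sign, zero for
horizontal-valued `L`; the other piece gives `2 dθ(u, L T)`. This is why `τ` does not appear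
explicitly in the final formula. -/
theorem trace_comp_torsion (L : TanAt n x →ₗ[ℝ] TanAt n x) (hL : ∀ v, L v ∈ S.H x) {u : TanAt n x}
    (hu : u ∈ S.H x) :
    LinearMap.trace ℝ (TanAt n x) (L ∘ₗ (cov.torsion x u).toLinearMap)
      = - 2 * P.webster x u (P.Jext x (L (P.reeb x))) := by
  have h : L ∘ₗ (cov.torsion x u).toLinearMap
      = ((2 : ℝ) • (P.dθ x u).toLinearMap).smulRight (L (P.reeb x))
        - (P.θ x).toLinearMap.smulRight (L (cov.torsion x (P.reeb x) u)) := by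
    rw [hcov.torsion_eq hu]
    ext v
    simp
  rw [h, map_sub, LinearMap.trace_smulRight, LinearMap.trace_smulRight, webster_Jext_right]
  simp [P.mem_H_iff.1 (hL _)]

/-- The trace of the square of the covariant derivative of the horizontal gradient. -/
theorem trace_cov_gradH_sq (hf : SmoothFnAt (n := n) f x) {X : Fin (2 * n) → TanAt n x}
    (hX : P.IsOrthonormalFrameH x X) :
    LinearMap.trace ℝ (TanAt n x)
        ((cov (P.gradH f) x).toLinearMap ∘ₗ (cov (P.gradH f) x).toLinearMap)
      = (∑ j, ∑ k, (cov.hessian f x (X j) (X k)) ^ 2)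
        - 2 * dirDeriv f x (P.reeb x)
          * LinearMap.trace ℝ (TanAt n x) (P.Jext x ∘ₗ (cov (P.gradH f) x).toLinearMap) := by
  have hA : ∀ v, cov (P.gradH f) x v ∈ S.H x :=
    hcov.cov_mem (P.gradH_mem f) (P.smoothFieldAt_gradH hf).diff
  have hexp : ∀ k, ∀ L : TanAt n x →ₗ[ℝ] ℝ, L (cov (P.gradH f) x (X k))
      = ∑ j, cov.hessian f x (X k) (X j) * L (X j) := fun k L ↦ by
    conv_lhs => rw [← hX.sum_webster_smul (hA (X k)), map_sum]
    refine Finset.sum_congr rfl fun j _ ↦ ?_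
    rw [map_smul, hcov.hessian_eq hf _ (hX.1 j), smul_eq_mul]
  rw [hX.trace_eq, hX.trace_eq]
  simp only [LinearMap.comp_apply, ContinuousLinearMap.coe_coe, P.mem_H_iff.1 (hA _), theta_Jext,
    add_zero]
  rw [Finset.mul_sum, ← Finset.sum_sub_distrib]
  refine Finset.sum_congr rfl fun k _ ↦ ?_
  have h1 := hexp k ((P.webster x).flip (X k) ∘ₗ (cov (P.gradH f) x).toLinearMap)
  have h2 := hexp k ((P.webster x).flip (P.Jext x (X k)))
  simp only [LinearMap.comp_apply, ContinuousLinearMap.coe_coe,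
    LinearMap.BilinForm.flip_apply] at h1 h2
  rw [webster_Jext_left, h1, h2, mul_neg, sub_neg_eq_add, Finset.mul_sum,
    ← Finset.sum_add_distrib]
  refine Finset.sum_congr rfl fun j _ ↦ ?_
  -- The trace of `A²` pairs `Hess(X_k, X_j)` with `Hess(X_j, X_k)`; the swap makes it a square, and
  -- the excess is a summand of the multiple of `tr(JA)`.
  rw [← hcov.hessian_eq hf _ (hX.1 k), hcov.hessian_swap_of_mem hf (hX.1 j) (hX.1 k)]
  ring

end IsTanakaWebster

end StrictlyPseudoconvexStructure

end

/-! ### The Bochner-type formula. -/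

theorem mainTheorem2 (n : ℕ) (M : Type*) [TopologicalSpace M] [T2Space M]
    [ChartedSpace (ModelE n) M] [IsManifold (𝓡 (2 * n + 1)) ∞ M]
    (S : CRStructure n M) (P : StrictlyPseudoconvexStructure S)
    (cov : LinearConnection n M) (hcov : P.IsTanakaWebster cov)
    (f : M → ℝ) (hf : ContMDiff (𝓡 (2 * n + 1)) 𝓘(ℝ, ℝ) ∞ f)
    (x : M) (X : Fin (2 * n) → TanAt n x) (hX : P.IsOrthonormalFrameH x X) :
    (1 / 2) * P.sublaplacian (fun y ↦ P.webster y (P.gradH f y) (P.gradH f y)) x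
      = (∑ j, ∑ k, (cov.hessian f x (X j) (X k)) ^ 2)
        + dirDeriv (P.sublaplacian f) x (P.gradH f x)
        + cov.ricci x (P.gradH f x) (P.gradH f x)
        + 2 * P.opL cov f x := by
  have hs : ∀ y, SmoothFnAt (n := n) f y := hf
  have hh : SmoothField (P.gradH f) := fun y ↦ P.smoothFieldAt_gradH (hs y)
  have hm := P.gradH_mem f
  have hA : ∀ v, cov (P.gradH f) x v ∈ S.H x := hcov.cov_mem hm (hh x).diff
  have hTf := fun y ↦ (hs y).dirDeriv (P.smoothFieldAt_reeb y)
  have hC := smoothField_covField hcov.smooth hh hh x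
  have ha : SmoothFnAt (n := n) (fun y ↦ 2 * dirDeriv f y (P.reeb y)) x :=
    contMDiffAt_const.mul (hTf x)
  have hD : SmoothFieldAt
      (fun y ↦ (2 * dirDeriv f y (P.reeb y)) • P.Jext y (P.gradH f y)) x :=
    SmoothFieldAt.smul ha (P.smoothFieldAt_Jext (hh x))
  have hCD : DiffFieldAt (fun y ↦ covField cov (P.gradH f) (P.gradH f) y
      + (2 * dirDeriv f y (P.reeb y)) • P.Jext y (P.gradH f y)) x := (hC.add hD).diff
  have hgrad : P.gradH (fun y ↦ P.webster y (P.gradH f y) (P.gradH f y))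
      = fun y ↦ (2 : ℝ) • (covField cov (P.gradH f) (P.gradH f) y
        + (2 * dirDeriv f y (P.reeb y)) • P.Jext y (P.gradH f y)) :=
    funext fun y ↦ hcov.gradH_sq (hs y)
  have hcovgrad : (cov (P.gradH (fun y ↦ P.webster y (P.gradH f y) (P.gradH f y))) x).toLinearMap
      = (2 : ℝ) • ((cov (covField cov (P.gradH f) (P.gradH f)) x).toLinearMap
        + (cov (fun y ↦ (2 * dirDeriv f y (P.reeb y)) • P.Jext y (P.gradH f y))
          x).toLinearMap) := by
    rw [hgrad]
    ext v
    rw [ContinuousLinearMap.coe_coe, cov_smul cov (a := fun _ ↦ 2) mdifferentiableAt_const hCD,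
      cov_add cov hC.diff hD.diff, dirDeriv_const]
    simp
  have hsub : P.sublaplacian f
      = fun y ↦ LinearMap.trace ℝ (TanAt n y) (cov (P.gradH f) y).toLinearMap :=
    funext fun y ↦ hcov.sublaplacian_eq (hs y)
  have hda : dirDeriv (fun y ↦ 2 * dirDeriv f y (P.reeb y)) x (P.Jext x (P.gradH f x))
      = 2 * dirDeriv (fun y ↦ dirDeriv f y (P.reeb y)) x (P.Jext x (P.gradH f x)) := by
    rw [dirDeriv_mul mdifferentiableAt_const (hTf x).diff, dirDeriv_const]
    ring
  -- After these substitutions the terms `± 2 (Tf) tr(JA)`, from `tr A²` and from the correction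
  -- field `2 (Tf) JY`, cancel. The derivative of `Tf` along `JY` and the torsion trace form `2 Lf`.
  rw [hcov.sublaplacian_eq (P.smoothFnAt_webster (hh x) (hh x)), hcovgrad, map_smul, map_add,
    trace_cov_cov hcov.smooth hh, hcov.trace_cov_smul_Jext ha (hh x) hm,
    hcov.trace_cov_gradH_sq (hs x) hX, hcov.trace_comp_torsion _ hA (hm x), hda, hsub,
    P.webster_gradH f (P.Jext_mem x _), StrictlyPseudoconvexStructure.opL, smul_eq_mul]
  simp only [ContinuousLinearMap.coe_coe]
  ring
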